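/- Let $n\ge 0$ and let $G_{\mathbb R}\subset \mathrm{GL}_n(\mathbb C)$ be a closed connected subgroup whose Lie algebra $\mathfrak g_{\mathbb R}=\{X\in M_n(\mathbb C)\mid \exp(tX)\in G_{\mathbb R}\ \text{for all } t\in\mathbb R\}$ is a simple real Lie algebra with $\mathfrak g_{\mathbb R}\cap i\mathfrak g_{\mathbb R}=0$ (every connected simple linear real Lie group can be so embedded). Let $\mathfrak g=\mathfrak g_{\mathbb R}\oplus i\mathfrak g_{\mathbb R}$ be the complexification of $\mathfrak g_{\mathbb R}$ and let $G\subset\mathrm{GL}_n(\mathbb C)$ be the complexification of $G_{\mathbb R}$, i.e. the connected subgroup with Lie algebra $\mathfrak g$, generated by $\exp(\mathfrak g)$. Both groups act by $g\cdot X=gXg^{-1}$. Closures are taken in the usual topology. For $x\in\mathfrak g_{\mathbb R}$ put $$\lim_{\nu\to0^+}G_{\mathbb R}\cdot(\nu x)=\bigcap_{\epsilon>0}\overline{\bigcup_{0<\nu<\epsilon}G_{\mathbb R}\cdot(\nu x)} .$$ A standard triple is a triple $\{h,e,f\}\subset\mathfrak g_{\mathbb R}$ with $[h,e]=2e$, $[h,f]=-2f$,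 $[e,f]=h$ (for $e=0$ this is the zero triple); $h$ is its neutral element. For a nilpotent $e\in\mathfrak g_{\mathbb R}$ let $\mathcal L(e)=\lim_{\nu\to0^+}G_{\mathbb R}\cdot(\nu h)$, where $h$ is the neutral element of any standard triple in $\mathfrak g_{\mathbb R}$ containing $e$; this does not depend on the triple, and $\mathcal L(0)=\{0\}$. For the neutral element $h$ of a standard triple let $\mathfrak u(h)\subset\mathfrak g$ and $\mathfrak u_{\mathbb R}(h)\subset\mathfrak g_{\mathbb R}$ be the sums of the eigenspaces of $\mathrm{ad}(h)$ for the positive eigenvalues on $\mathfrak g$ and on $\mathfrak g_{\mathbb R}$ respectively. Let $\mathcal O_{\mathrm{Rich}}(h)$ be the Richardson orbit of $h$, i.e. the unique $G$-orbit that is dense in $G\cdot\mathfrak u(h)$. The real forms of a $G$-orbit $\mathcal O\subset\mathfrak g$ are the $G_{\mathbb R}$-orbits contained in $\mathcal O\cap\mathfrak g_{\mathbb R}$. **Proposition.** Let $e\in\mathfrak g_{\mathbb R}$ be nilpotent and let $\{h,e,f\}\subset\mathfrak g_{\mathbb R}$ be a standard triple containing $e$. Assume that $\mathcal O_{\mathrm{Rich}}(h)$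 has at least one real form and that every real form of $\mathcal O_{\mathrm{Rich}}(h)$ meets $\mathfrak u_{\mathbb R}(h)$. Then $$\mathcal L(e)=\overline{\mathcal O_{\mathrm{Rich}}(h)\cap\mathfrak g_{\mathbb R}} .$$ -/

import Mathlib

/- ## The Lie algebra of a closed matrix group -/

section LieAlgebraOfClosedSubgroup

open NormedSpace Topology Filter

/-- If a curve through `1` stays in a closed group `H` of units and has velocity `Z` at `0`, then
`exp Z` is in `H`. -/
theorem exists_mem_closedSubgroup_exp {A : Type*} [NormedRing A] [NormedAlgebra ℝ A]
    [CompleteSpace A] (H : ClosedSubgroup Aˣ) {c : ℝ → A} {Z : A} (hc : HasDerivAt c Z 0)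
    (h1 : c 0 = 1) (hH : ∀ s, ∃ g ∈ H, (g : A) = c s) : ∃ g ∈ H, (g : A) = exp Z := by
  let _ : NormedAlgebra ℚ A := NormedAlgebra.restrictScalars ℚ ℝ A
  have hs : HasStrictFDerivAt (exp : A → A)
      ((ContinuousLinearEquiv.refl ℝ A : A ≃L[ℝ] A) : A →L[ℝ] A) 0 :=
    (hasStrictFDerivAt_exp_zero (𝕂 := ℝ) (𝔸 := A))
  set L := hs.localInverse exp _ 0 with hL
  have hLd : HasStrictFDerivAt L
      (((ContinuousLinearEquiv.refl ℝ A).symm : A ≃L[ℝ] A) : A →L[ℝ] A) (exp 0) :=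
    hs.to_localInverse
  rw [exp_zero] at hLd
  have hL1 : L 1 = 0 := by
    have := hs.localInverse_apply_image
    rwa [exp_zero] at this
  have hev : ∀ᶠ y in 𝓝 (1 : A), exp (L y) = y := by
    have := hs.eventually_right_inverse
    rwa [exp_zero] at this
  have hd : HasDerivAt (fun s => L (c s)) Z 0 := by
    have h2 : HasFDerivAt L
      (((ContinuousLinearEquiv.refl ℝ A).symm : A ≃L[ℝ] A) : A →L[ℝ] A) (c 0) := by
      rw [h1]; exact hLd.hasFDerivAt
    exact h2.comp_hasDerivAt (0 : ℝ) hc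
  have hu : Tendsto (fun k : ℕ => ((k : ℝ) + 1)⁻¹) atTop (𝓝[≠] 0) := by
    refine tendsto_nhdsWithin_iff.2 ⟨?_, Eventually.of_forall fun k => ?_⟩
    · simpa [one_div] using tendsto_one_div_add_atTop_nhds_zero_nat (𝕜 := ℝ)
    · have : (0 : ℝ) < (k : ℝ) + 1 := by positivity
      exact (inv_pos.2 this).ne'
  have hlim : Tendsto (fun k : ℕ => ((k : ℝ) + 1) • L (c ((k : ℝ) + 1)⁻¹)) atTop (𝓝 Z) := by
    have := (hasDerivAt_iff_tendsto_slope_zero.1 hd).comp hu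
    simpa [Function.comp_def, h1, hL1] using this
  have hlim2 := ((exp_continuous (𝔸 := A)).tendsto Z).comp hlim
  have hcev : ∀ᶠ k : ℕ in atTop, exp (L (c ((k : ℝ) + 1)⁻¹)) = c ((k : ℝ) + 1)⁻¹ := by
    have h3 : Tendsto (fun k : ℕ => c ((k : ℝ) + 1)⁻¹) atTop (𝓝 1) := by
      rw [← h1]
      exact hc.continuousAt.tendsto.comp (hu.mono_right nhdsWithin_le_nhds)
    exact h3.eventually hev
  choose g hgH hg using hH
  obtain ⟨u, hu'⟩ : IsUnit (exp Z) := isUnit_exp Z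
  refine ⟨u, ?_, hu'⟩
  have hlim3 : Tendsto (fun k : ℕ => (g ((k : ℝ) + 1)⁻¹) ^ (k + 1)) atTop (𝓝 u) := by
    rw [Units.isOpenEmbedding_val.isInducing.tendsto_nhds_iff, hu']
    refine hlim2.congr' ?_
    filter_upwards [hcev] with k hk
    have : ((k : ℝ) + 1) • L (c ((k : ℝ) + 1)⁻¹) = (k + 1) • L (c ((k : ℝ) + 1)⁻¹) := by
      rw [← Nat.cast_smul_eq_nsmul ℝ]; push_cast; rfl
    simp only [Function.comp_apply, this, exp_nsmul, hk, Units.val_pow_eq_pow_val, hg]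
  exact H.isClosed'.mem_of_tendsto hlim3 (Eventually.of_forall fun k => pow_mem (hgH _) _)

/-- The generators of the one-parameter subgroups of a closed group of units form a subspace. -/
def ClosedSubgroup.generators {A : Type*} [NormedRing A] [NormedAlgebra ℝ A] [CompleteSpace A]
    (H : ClosedSubgroup Aˣ) : Submodule ℝ A where
  carrier := {X | ∀ t : ℝ, ∃ g ∈ H, (g : A) = exp (t • X)}
  zero_mem' := fun t => ⟨1, one_mem H, by simp⟩
  smul_mem' := fun a X hX t => by simpa only [mul_smul] using hX (t * a)
  add_mem' := by
    intro X Y hX hY t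
    have hd : HasDerivAt (fun s : ℝ => exp (s • (t • X)) * exp (s • (t • Y)))
        (t • (X + Y)) 0 := by
      have h1 := (hasDerivAt_exp_smul_const (𝕂 := ℝ) (t • X) (0 : ℝ)).mul
        (hasDerivAt_exp_smul_const (𝕂 := ℝ) (t • Y) (0 : ℝ))
      have h2 : HasDerivAt (fun s : ℝ => exp (s • (t • X)) * exp (s • (t • Y))) _ 0 := h1
      simpa using h2
    refine exists_mem_closedSubgroup_exp H hd (by simp) fun s => ?_
    obtain ⟨g, hg, hg'⟩ := hX (s * t)
    obtain ⟨k, hk, hk'⟩ := hY (s * t)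
    exact ⟨g * k, mul_mem hg hk, by simp [hg', hk', mul_smul]⟩

theorem ClosedSubgroup.lie_mem_generators {A : Type*} [NormedRing A] [NormedAlgebra ℝ A]
    [CompleteSpace A] [FiniteDimensional ℝ A] (H : ClosedSubgroup Aˣ) {X Y : A}
    (hX : X ∈ H.generators) (hY : Y ∈ H.generators) : X * Y - Y * X ∈ H.generators := by
  let _ : NormedAlgebra ℚ A := NormedAlgebra.restrictScalars ℚ ℝ A
  have hcl : IsClosed (H.generators : Set A) := Submodule.closed_of_finiteDimensional _
  have hmem : ∀ s : ℝ, exp (s • X) * Y * exp (s • (-X)) ∈ H.generators := by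
    intro s t
    obtain ⟨g, hg, hg'⟩ := hX s
    obtain ⟨k, hk, hk'⟩ := hY t
    refine ⟨g * k * g⁻¹, mul_mem (mul_mem hg hk) (inv_mem hg), ?_⟩
    have hgi : ((g⁻¹ : Aˣ) : A) = exp (s • (-X)) := by
      rw [Units.inv_eq_of_mul_eq_one_right]
      rw [hg', smul_neg, ← exp_add_of_commute (Commute.neg_right (Commute.refl _))]
      simp
    rw [← hg', ← hgi]
    have : t • ((g : A) * Y * ((g⁻¹ : Aˣ) : A)) = (g : A) * (t • Y) * ((g⁻¹ : Aˣ) : A) := by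
      simp
    rw [this, exp_units_conj, ← hk']
    simp
  have hd : HasDerivAt (fun s : ℝ => exp (s • X) * Y * exp (s • (-X))) (X * Y - Y * X) 0 := by
    have h1 := ((hasDerivAt_exp_smul_const (𝕂 := ℝ) X (0 : ℝ)).mul_const Y).mul
      (hasDerivAt_exp_smul_const (𝕂 := ℝ) (-X) (0 : ℝ))
    have h2 : HasDerivAt (fun s : ℝ => exp (s • X) * Y * exp (s • (-X))) _ 0 := h1
    simpa [sub_eq_add_neg] using h2
  refine hcl.mem_of_tendsto (hasDerivAt_iff_tendsto_slope.1 hd) (Eventually.of_forall fun s => ?_)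
  rw [slope_def_module]
  exact H.generators.smul_mem _ (H.generators.sub_mem (hmem _) (hmem _))

end LieAlgebraOfClosedSubgroup

-- The bracket of matrices is the commutator.
attribute [local instance] LieRing.ofAssociativeRing

noncomputable section AdjointOrbits

open NormedSpace Matrix

variable {n : ℕ}

/-- The Lie algebra of a closed subgroup `GR` of `GL n ℂ`, as a real Lie subalgebra of the
complex matrices: all `X` such that `exp (t X)` is in `GR` for every real `t`. -/
def lieAlgebraOf (GR : ClosedSubgroup (GL (Fin n) ℂ)) :
    LieSubalgebra ℝ (Matrix (Fin n) (Fin n) ℂ) where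
  carrier := {X | ∀ t : ℝ, ∃ g ∈ GR, (g : Matrix (Fin n) (Fin n) ℂ) = exp (t • X)}
  zero_mem' := by
    let _ : NormedRing (Matrix (Fin n) (Fin n) ℂ) := Matrix.linftyOpNormedRing
    let _ : NormedAlgebra ℝ (Matrix (Fin n) (Fin n) ℂ) := Matrix.linftyOpNormedAlgebra
    exact GR.generators.zero_mem
  add_mem' := by
    let _ : NormedRing (Matrix (Fin n) (Fin n) ℂ) := Matrix.linftyOpNormedRing
    let _ : NormedAlgebra ℝ (Matrix (Fin n) (Fin n) ℂ) := Matrix.linftyOpNormedAlgebra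
    exact fun {_ _} hX hY => GR.generators.add_mem hX hY
  smul_mem' := by
    let _ : NormedRing (Matrix (Fin n) (Fin n) ℂ) := Matrix.linftyOpNormedRing
    let _ : NormedAlgebra ℝ (Matrix (Fin n) (Fin n) ℂ) := Matrix.linftyOpNormedAlgebra
    exact fun c X hX => GR.generators.smul_mem c hX
  lie_mem' := by
    let _ : NormedRing (Matrix (Fin n) (Fin n) ℂ) := Matrix.linftyOpNormedRing
    let _ : NormedAlgebra ℝ (Matrix (Fin n) (Fin n) ℂ) := Matrix.linftyOpNormedAlgebra
    exact fun {_ _} hX hY => GR.lie_mem_generators hX hY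

/-- The complexified Lie algebra `g = gR + i gR` inside the complex matrices. -/
def complexLieAlgebraOf (GR : ClosedSubgroup (GL (Fin n) ℂ)) :
    Submodule ℂ (Matrix (Fin n) (Fin n) ℂ) :=
  Submodule.span ℂ (lieAlgebraOf GR : Set (Matrix (Fin n) (Fin n) ℂ))

/-- The complexification `G` of `GR`: the connected subgroup of `GL n ℂ` with Lie algebra
`g = gR + i gR`, that is, the subgroup generated by the exponentials of the elements of `g`. -/
def complexification (GR : ClosedSubgroup (GL (Fin n) ℂ)) : Subgroup (GL (Fin n) ℂ) :=
  Subgroup.closure {g | ∃ X ∈ complexLieAlgebraOf GR, (g : Matrix (Fin n) (Fin n) ℂ) = exp X}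

/-- The adjoint orbit `H · X = {g X g⁻¹ | g ∈ H}`. -/
def adjointOrbit (H : Subgroup (GL (Fin n) ℂ)) (X : Matrix (Fin n) (Fin n) ℂ) :
    Set (Matrix (Fin n) (Fin n) ℂ) :=
  {Y | ∃ g ∈ H, Y = (g : Matrix (Fin n) (Fin n) ℂ) * X *
    ((g⁻¹ : GL (Fin n) ℂ) : Matrix (Fin n) (Fin n) ℂ)}

/-- The limit of the orbits `GR · (ν x)` as `ν → 0⁺`. -/
def limitOfOrbits (GR : ClosedSubgroup (GL (Fin n) ℂ)) (x : Matrix (Fin n) (Fin n) ℂ) :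
    Set (Matrix (Fin n) (Fin n) ℂ) :=
  ⋂ ε ∈ Set.Ioi (0 : ℝ), closure (⋃ ν ∈ Set.Ioo (0 : ℝ) ε, adjointOrbit GR.toSubgroup (ν • x))

/-- `{h, e, f}` is a standard triple. The zero triple is allowed; it is the only
standard triple with `e = 0`. -/
structure IsStandardTriple {L : Type*} [LieRing L] (h e f : L) : Prop where
  lie_h_e : ⁅h, e⁆ = 2 • e
  lie_h_f : ⁅h, f⁆ = -(2 • f)
  lie_e_f : ⁅e, f⁆ = h

/-- The set `L(e)`: the limit of the orbits `GR · (ν h)` as `ν → 0⁺`, where `h` is the neutral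
element of a standard triple in `gR` containing `e`. All such `h` are conjugate under `GR`, so the
sets in this union coincide. For `e = 0` the only triple is the zero triple and `L(0) = {0}`. -/
def limitSet (GR : ClosedSubgroup (GL (Fin n) ℂ)) (e : lieAlgebraOf GR) :
    Set (Matrix (Fin n) (Fin n) ℂ) :=
  ⋃ (h : lieAlgebraOf GR) (f : lieAlgebraOf GR) (_ : IsStandardTriple h e f),
    limitOfOrbits GR (h : Matrix (Fin n) (Fin n) ℂ)

/-- `uR(x)`: the sum of the eigenspaces of `ad x` on `gR` for the positive eigenvalues. -/
def realNilradical (GR : ClosedSubgroup (GL (Fin n) ℂ)) (x : Matrix (Fin n) (Fin n) ℂ) :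
    Submodule ℝ (Matrix (Fin n) (Fin n) ℂ) :=
  ⨆ μ ∈ Set.Ioi (0 : ℝ), (lieAlgebraOf GR).toSubmodule ⊓
    Module.End.eigenspace (LieAlgebra.ad ℝ (Matrix (Fin n) (Fin n) ℂ) x) μ

/-- `u(x)`: the sum of the eigenspaces of `ad x` on `g` for the positive eigenvalues. -/
def complexNilradical (GR : ClosedSubgroup (GL (Fin n) ℂ)) (x : Matrix (Fin n) (Fin n) ℂ) :
    Submodule ℂ (Matrix (Fin n) (Fin n) ℂ) :=
  ⨆ μ ∈ Set.Ioi (0 : ℝ), complexLieAlgebraOf GR ⊓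
    Module.End.eigenspace (LieAlgebra.ad ℂ (Matrix (Fin n) (Fin n) ℂ) x) (μ : ℂ)

/-- `G · u(x)`. -/
def nilradicalSaturation (GR : ClosedSubgroup (GL (Fin n) ℂ)) (x : Matrix (Fin n) (Fin n) ℂ) :
    Set (Matrix (Fin n) (Fin n) ℂ) :=
  ⋃ z ∈ complexNilradical GR x, adjointOrbit (complexification GR) z

/-- The Richardson orbit of a hyperbolic semisimple `x`: the unique dense `G`-orbit in `G · u(x)`,
described as the set of all points of `G · u(x)` whose `G`-orbit is dense in `G · u(x)`. (Orbits
being constructible, it does not matter whether density is understood in the usual topology, as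
here, or in the Zariski topology.) -/
def richardsonOrbit (GR : ClosedSubgroup (GL (Fin n) ℂ)) (x : Matrix (Fin n) (Fin n) ℂ) :
    Set (Matrix (Fin n) (Fin n) ℂ) :=
  {z ∈ nilradicalSaturation GR x |
    nilradicalSaturation GR x ⊆ closure (adjointOrbit (complexification GR) z)}

/-- The real forms of a `G`-orbit `O`: the `GR`-orbits contained in `O ∩ gR`. -/
def IsRealForm (GR : ClosedSubgroup (GL (Fin n) ℂ)) (O O' : Set (Matrix (Fin n) (Fin n) ℂ)) :
    Prop :=
  ∃ z ∈ O ∩ (lieAlgebraOf GR : Set (Matrix (Fin n) (Fin n) ℂ)), O' = adjointOrbit GR.toSubgroup z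

end AdjointOrbits

/-! Write u_R for the real nilradical of h and O for its Richardson orbit. The core of the argument
is that the limit of the orbits G_R·(νh) is the closure of G_R·u_R.

For ν > 0 and x in u_R, the element νh + x is conjugate to νh (`smul_add_mem_adjointOrbit`) and
tends to x as ν → 0, so G_R·u_R lies in the limit (`adjointOrbit_subset_limitOfOrbits`). Conversely,
every conjugate of νh lies within Cν of G_R·u_R, with C independent of the conjugating element
(`limitOfOrbits_subset_closure`). Classically this is compactness of the flag variety. Here it
follows from `exists_bounded_representative`: the shortest vector w of a translate of h + u
satisfies ‖w‖² = O(‖w‖), because ‖w‖² is a Killing pairing that can be computed from traces against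
orthogonal projections.

The hypothesis on real forms puts O ∩ g_R inside G_R·u_R, which gives one inclusion. The other needs
O ∩ u_R to be dense in u_R once it is nonempty (`realNilradical_subset_closure`). An orbit contains
a nonempty Zariski open part of its closure, and a real line through a point of that part leaves it
at only finitely many parameters. To obtain this openness from polynomial maps alone, G is replaced
by the group generated by the exponentials of complex multiples of nilpotent elements of g_R. Its
orbits are swept out by polynomial flows, so Chevalley's theorem applies
(`exists_eval_ne_zero_forall_flowReachable`). It is dense in G because nilpotent elements span g_R
when e ≠ 0 (`span_nilpotent_eq_top`).

The theory of sl₂ makes ad h diagonalizable with integer eigenvalues, and shows that neutral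
elements of triples through the same e differ by an element of u_R, hence are conjugate
(`limitSet_eq_limitOfOrbits`). -/

/-! ## Representations of `sl₂` given by three endomorphisms -/

section SlTwo

open Module Polynomial

variable {K V : Type*} [Field K] [AddCommGroup V] [Module K V]

/-- Induction on the roots: `T - a` maps the sum of the eigenspaces for `b ≠ a` onto itself, so `v`
can be corrected by a vector of that sum to become an `a`-eigenvector. Carrying `W` along keeps the
eigenvectors inside a stable subspace, later the kernel of `E`. -/
theorem mem_iSup_eigenspace_of_aeval_prod_eq_zero (T : End K V) (W : Submodule K V)
    (hW : ∀ v ∈ W, T v ∈ W) (s : Finset K) (v : V) (hv : v ∈ W)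
    (h : aeval T (∏ a ∈ s, (X - C a)) v = 0) :
    v ∈ ⨆ a ∈ s, W ⊓ T.eigenspace a := by
  classical
  induction s using Finset.induction_on generalizing v with
  | empty => simpa using h
  | insert a s ha ih =>
    have h1 : aeval T (∏ b ∈ s, (X - C b)) (T v - a • v) = 0 := by
      rw [Finset.prod_insert ha, mul_comm, map_mul, Module.End.mul_apply] at h
      simpa using h
    have h2 := ih _ (W.sub_mem (hW v hv) (W.smul_mem a hv)) h1
    have key : ∀ w ∈ ⨆ b ∈ s, W ⊓ T.eigenspace b,
        ∃ w' ∈ ⨆ b ∈ s, W ⊓ T.eigenspace b, T w' - a • w' = w := by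
      intro w hw
      rw [← Submodule.mem_toAddSubmonoid] at hw
      have : (⨆ b ∈ s, W ⊓ T.eigenspace b) ≤
          (⨆ b ∈ s, W ⊓ T.eigenspace b).map (T - a • (1 : End K V)) := by
        refine iSup₂_le fun b hb x hx => ?_
        have hba : b - a ≠ 0 := sub_ne_zero.2 fun h => ha (h ▸ hb)
        refine ⟨(b - a)⁻¹ • x, Submodule.smul_mem _ _
          (Submodule.mem_iSup_of_mem b (Submodule.mem_iSup_of_mem hb hx)), ?_⟩
        have hx2 := End.mem_eigenspace_iff.1 hx.2
        simp only [map_smul, LinearMap.sub_apply, LinearMap.smul_apply, End.one_apply, hx2]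
        rw [← sub_smul, smul_smul, inv_mul_cancel₀ hba, one_smul]
      obtain ⟨w', hw', h'⟩ := this hw
      exact ⟨w', hw', by simpa using h'⟩
    obtain ⟨w', hw', h'⟩ := key _ h2
    have hle : (⨆ b ∈ s, W ⊓ T.eigenspace b) ≤ ⨆ b ∈ insert a s, W ⊓ T.eigenspace b :=
      biSup_mono fun b hb => Finset.mem_insert_of_mem hb
    have hleW : (⨆ b ∈ s, W ⊓ T.eigenspace b) ≤ W := iSup₂_le fun b _ => inf_le_left
    have h3 : v - w' ∈ W ⊓ T.eigenspace a := by
      refine ⟨W.sub_mem hv (hleW hw'), End.mem_eigenspace_iff.2 ?_⟩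
      rw [map_sub, smul_sub, sub_eq_sub_iff_sub_eq_sub, h']
    rw [← sub_add_cancel v w']
    exact Submodule.add_mem _ (Submodule.mem_iSup_of_mem a
      (Submodule.mem_iSup_of_mem (Finset.mem_insert_self a s) h3)) (hle hw')

/-- The powers `T ^ k` are eigenvectors of the commutator with `H` for the distinct eigenvalues `k *
c`. If none vanished they would be infinitely many independent vectors in a finite-dimensional
space. -/
theorem isNilpotent_of_commutator_eq_smul [CharZero K] [FiniteDimensional K V] (H T : End K V)
    {c : K} (hc : c ≠ 0) (h : H * T - T * H = c • T) : IsNilpotent T := by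
  have hk : ∀ k : ℕ, H * T ^ k - T ^ k * H = (k * c) • T ^ k := by
    intro k
    induction k with
    | zero => simp
    | succ k ih =>
      have : H * T ^ (k + 1) - T ^ (k + 1) * H =
          (H * T ^ k - T ^ k * H) * T + T ^ k * (H * T - T * H) := by
        rw [pow_succ]; noncomm_ring
      rw [this, ih, h, smul_mul_assoc, mul_smul_comm, ← pow_succ, ← add_smul]
      push_cast; ring_nf
  by_contra hT
  have hne : ∀ k, T ^ k ≠ 0 := fun k hk => hT ⟨k, hk⟩
  let D : End K (End K V) := LinearMap.mulLeft K H - LinearMap.mulRight K H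
  have hinj : Function.Injective fun k : ℕ => (k : K) * c := fun a b hab => by
    simpa [hc] using hab
  have hli := End.eigenvectors_linearIndependent' D (fun k : ℕ => (k : K) * c) hinj
    (fun k => T ^ k) fun k => ⟨End.mem_eigenspace_iff.2 (by simpa [D] using hk k), hne k⟩
  exact not_finite_iff_infinite.2 (inferInstance : Infinite ℕ) hli.finite

/-- Three endomorphisms satisfying the relations of `sl₂`. -/
structure IsSlTwoRep (H E F : End K V) : Prop where
  he : H * E - E * H = (2 : K) • E
  hf : H * F - F * H = (-2 : K) • F
  ef : E * F - F * E = H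

namespace IsSlTwoRep

variable {H E F : End K V}

theorem apply_he (t : IsSlTwoRep H E F) (v : V) : H (E v) = E (H v) + (2 : K) • E v := by
  have := LinearMap.congr_fun t.he v
  simp only [LinearMap.sub_apply, End.mul_apply, LinearMap.smul_apply] at this
  rw [← this]; abel

theorem apply_hf (t : IsSlTwoRep H E F) (v : V) : H (F v) = F (H v) - (2 : K) • F v := by
  have := LinearMap.congr_fun t.hf v
  simp only [LinearMap.sub_apply, End.mul_apply, neg_smul] at this
  rw [sub_eq_add_neg, ← LinearMap.smul_apply, ← LinearMap.neg_apply, ← this]; abel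

theorem apply_ef (t : IsSlTwoRep H E F) (v : V) : E (F v) = F (E v) + H v := by
  have := LinearMap.congr_fun t.ef v
  simp only [LinearMap.sub_apply, End.mul_apply] at this
  rw [← this]; abel

theorem apply_h_pow_f (t : IsSlTwoRep H E F) (k : ℕ) (v : V) :
    H ((F ^ k) v) = (F ^ k) (H v) - (2 * k : K) • (F ^ k) v := by
  induction k with
  | zero => simp
  | succ k ih =>
    rw [pow_succ', End.mul_apply, t.apply_hf, ih, map_sub, map_smul, End.mul_apply]
    push_cast
    module

theorem apply_e_pow_f (t : IsSlTwoRep H E F) (k : ℕ) {v : V} (hv : E v = 0) :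
    E ((F ^ (k + 1)) v) = ((k : K) + 1) • (F ^ k) (H v - (k : K) • v) := by
  induction k with
  | zero => simp [t.apply_ef, hv]
  | succ k ih =>
    have h1 : ∀ x, F ((F ^ k) x) = (F ^ (k + 1)) x := fun x => by
      rw [pow_succ', End.mul_apply]
    rw [pow_succ', End.mul_apply, t.apply_ef, ih, t.apply_h_pow_f, map_smul, h1, map_sub, map_sub,
      map_smul, map_smul]
    push_cast
    module

theorem mem_ker_e_h (t : IsSlTwoRep H E F) {v : V} (hv : v ∈ LinearMap.ker E) :
    H v ∈ LinearMap.ker E := by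
  have := t.apply_he v
  rw [LinearMap.mem_ker] at hv ⊢
  simpa [hv] using this.symm

/-- Here `v` need not be a weight vector. As soon as `F ^ k = 0`, the identity exhibits a polynomial
with simple natural roots that kills `H` on the kernel of `E`, so `H` is diagonalizable there. -/
theorem pow_e_pow_f (t : IsSlTwoRep H E F) (k : ℕ) {v : V} (hv : v ∈ LinearMap.ker E) :
    (E ^ k) ((F ^ k) v) =
      (k.factorial : K) • aeval H (∏ a ∈ Finset.range k, (X - C (a : K))) v := by
  induction k generalizing v with
  | zero => simp
  | succ k ih =>
    have h1 : H v - (k : K) • v ∈ LinearMap.ker E :=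
      Submodule.sub_mem _ (t.mem_ker_e_h hv) (Submodule.smul_mem _ _ hv)
    rw [pow_succ, End.mul_apply, t.apply_e_pow_f k (LinearMap.mem_ker.1 hv), map_smul, ih h1,
      Finset.prod_range_succ, map_mul, End.mul_apply, smul_smul, Nat.factorial_succ]
    simp [Nat.cast_smul_eq_nsmul]

theorem quotient (t : IsSlTwoRep H E F) (W : Submodule K V) (hH : W ≤ W.comap H)
    (hE : W ≤ W.comap E) (hF : W ≤ W.comap F) :
    IsSlTwoRep (W.mapQ W H hH) (W.mapQ W E hE) (W.mapQ W F hF) := by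
  refine ⟨?_, ?_, ?_⟩ <;> refine Submodule.linearMap_qext _ (LinearMap.ext fun v => ?_)
  · simp [t.apply_he]
  · simp [← Submodule.Quotient.mk_sub, t.apply_hf]
  · simp [t.apply_ef]

/-- The span of the vectors `F ^ k v` with `v` a primitive weight vector. -/
def primitiveSpan (H E F : End K V) : Submodule K V :=
  Submodule.span K {x | ∃ (v : V) (j k : ℕ), E v = 0 ∧ H v = (j : K) • v ∧ x = (F ^ k) v}

theorem primitiveSpan_le_h (t : IsSlTwoRep H E F) :
    primitiveSpan H E F ≤ (primitiveSpan H E F).comap H := by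
  refine Submodule.span_le.2 ?_
  rintro _ ⟨v, j, k, hv, hj, rfl⟩
  simp only [Submodule.comap_coe, Set.mem_preimage, SetLike.mem_coe]
  rw [t.apply_h_pow_f, hj, map_smul, ← sub_smul]
  exact Submodule.smul_mem _ _ (Submodule.subset_span ⟨v, j, k, hv, hj, rfl⟩)

theorem primitiveSpan_le_f : primitiveSpan H E F ≤ (primitiveSpan H E F).comap F := by
  refine Submodule.span_le.2 ?_
  rintro _ ⟨v, j, k, hv, hj, rfl⟩
  exact Submodule.subset_span ⟨v, j, k + 1, hv, hj, by rw [pow_succ', End.mul_apply]⟩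

theorem primitiveSpan_le_e (t : IsSlTwoRep H E F) :
    primitiveSpan H E F ≤ (primitiveSpan H E F).comap E := by
  refine Submodule.span_le.2 ?_
  rintro _ ⟨v, j, k, hv, hj, rfl⟩
  simp only [Submodule.comap_coe, Set.mem_preimage, SetLike.mem_coe]
  cases k with
  | zero => simp [hv]
  | succ k =>
    rw [t.apply_e_pow_f k hv, hj, ← sub_smul, map_smul]
    exact Submodule.smul_mem _ _ (Submodule.smul_mem _ _
      (Submodule.subset_span ⟨v, j, k, hv, hj, rfl⟩))

/-- A weight vector of positive weight modulo `E (primitiveSpan)` is zero. -/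
theorem mem_map_e_primitiveSpan [CharZero K] (t : IsSlTwoRep H E F) {m : V} (hm : m ∈ primitiveSpan H E F)
    (j : ℕ) (h : H m - ((j : K) + 2) • m ∈ (primitiveSpan H E F).map E) :
    m ∈ (primitiveSpan H E F).map E := by
  set P := primitiveSpan H E F
  set N := P.map E
  have hN : N ≤ N.comap H := by
    rintro _ ⟨x, hx, rfl⟩
    rw [Submodule.mem_comap, t.apply_he, ← map_smul, ← map_add]
    exact Submodule.mem_map_of_mem (P.add_mem (t.primitiveSpan_le_h hx) (P.smul_mem _ hx))
  set Hq : End K (V ⧸ N) := N.mapQ N H hN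
  -- A generator `F ^ k v` of positive weight `i - 2k` is a nonzero multiple of `E (F ^ (k + 1) v)`,
  -- hence zero modulo `N`. The other generators have weight at most 0, which differs from `j + 2`.
  have h1 : P ≤ (⨆ c ≠ ((j : K) + 2), Hq.eigenspace c).comap N.mkQ := by
    refine Submodule.span_le.2 ?_
    rintro _ ⟨v, i, k, hv, hi, rfl⟩
    simp only [Submodule.comap_coe, Set.mem_preimage, SetLike.mem_coe]
    by_cases hik : 2 * k < i
    · have : (F ^ k) v ∈ N := by
        have h2 := t.apply_e_pow_f k hv
        rw [hi, ← sub_smul, map_smul, smul_smul] at h2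
        have h3 : ((k : K) + 1) * ((i : K) - k) ≠ 0 := by
          refine mul_ne_zero (by exact_mod_cast k.succ_ne_zero) (sub_ne_zero.2 ?_)
          exact_mod_cast (by omega : i ≠ k)
        refine (Submodule.smul_mem_iff N h3).1 ?_
        rw [← h2]
        exact Submodule.mem_map_of_mem (Submodule.subset_span ⟨v, i, k + 1, hv, hi, rfl⟩)
      rw [Submodule.mkQ_apply, (Submodule.Quotient.mk_eq_zero N).2 this]
      exact Submodule.zero_mem _
    · have h4 : (i : K) - 2 * k ≠ (j : K) + 2 := by
        intro h4
        have : (i : K) = j + 2 + 2 * k := by linear_combination h4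
        have : i = j + 2 + 2 * k := by exact_mod_cast this
        omega
      refine Submodule.mem_iSup_of_mem _ (Submodule.mem_iSup_of_mem h4 ?_)
      rw [End.mem_eigenspace_iff]
      simp only [Hq, Submodule.mkQ_apply, Submodule.mapQ_apply]
      rw [t.apply_h_pow_f, hi, map_smul, ← sub_smul, Submodule.Quotient.mk_smul]
  have h2 : N.mkQ m ∈ Hq.eigenspace ((j : K) + 2) := by
    rw [End.mem_eigenspace_iff]
    simp only [Hq, Submodule.mkQ_apply, Submodule.mapQ_apply]
    rw [← sub_eq_zero, ← Submodule.Quotient.mk_smul, ← Submodule.Quotient.mk_sub]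
    exact (Submodule.Quotient.mk_eq_zero N).2 h
  have h3 := ((End.eigenspaces_iSupIndep Hq) ((j : K) + 2)).le_bot ⟨h2, h1 hm⟩
  exact (Submodule.Quotient.mk_eq_zero N).1 h3

variable [CharZero K] [FiniteDimensional K V]

theorem isNilpotent_e (t : IsSlTwoRep H E F) : IsNilpotent E :=
  isNilpotent_of_commutator_eq_smul H E two_ne_zero t.he

theorem isNilpotent_f (t : IsSlTwoRep H E F) : IsNilpotent F :=
  isNilpotent_of_commutator_eq_smul H F (by norm_num) t.hf

theorem ker_e_le (t : IsSlTwoRep H E F) :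
    LinearMap.ker E ≤ ⨆ k : ℕ, LinearMap.ker E ⊓ H.eigenspace (k : K) := by
  classical
  obtain ⟨N, hN⟩ := t.isNilpotent_f
  intro v hv
  have h1 := t.pow_e_pow_f N hv
  rw [hN, LinearMap.zero_apply, map_zero, eq_comm, smul_eq_zero] at h1
  have h2 := h1.resolve_left (by exact_mod_cast N.factorial_ne_zero)
  have h3 : ∏ a ∈ Finset.range N, (X - C (a : K)) =
      ∏ a ∈ (Finset.range N).image (fun k : ℕ => (k : K)), (X - C a) := by
    rw [Finset.prod_image fun a _ b _ hab => Nat.cast_injective hab]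
  rw [h3] at h2
  have h4 := mem_iSup_eigenspace_of_aeval_prod_eq_zero H _ (fun w hw => t.mem_ker_e_h hw) _ v hv h2
  refine (iSup₂_le fun a ha => ?_ : _ ≤ ⨆ k : ℕ, LinearMap.ker E ⊓ H.eigenspace (k : K)) h4
  obtain ⟨k, -, rfl⟩ := Finset.mem_image.1 ha
  exact le_iSup (fun k : ℕ => LinearMap.ker E ⊓ H.eigenspace (k : K)) k

theorem exists_nat_of_mem_ker_e (t : IsSlTwoRep H E F) {v : V} (hv : E v = 0) (h0 : v ≠ 0) {c : K}
    (hc : H v = c • v) : ∃ k : ℕ, c = k := by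
  by_contra! hcon
  have h1 : v ∈ ⨆ k : ℕ, LinearMap.ker E ⊓ H.eigenspace (k : K) := t.ker_e_le hv
  have h2 : (⨆ k : ℕ, LinearMap.ker E ⊓ H.eigenspace (k : K)) ≤ ⨆ j ≠ c, H.eigenspace j :=
    iSup_le fun k => inf_le_right.trans
      (le_iSup₂_of_le (f := fun j (_ : j ≠ c) => H.eigenspace j) (k : K) (hcon k).symm le_rfl)
  exact h0 (((End.eigenspaces_iSupIndep H) c).le_bot
    ⟨End.mem_eigenspace_iff.2 hc, h2 h1⟩)

theorem exists_nat_eigenvector [Nontrivial V] (t : IsSlTwoRep H E F) :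
    ∃ v ≠ 0, E v = 0 ∧ ∃ k : ℕ, H v = (k : K) • v := by
  have hker : LinearMap.ker E ≠ ⊥ := by
    intro hb
    obtain ⟨N, hN⟩ := t.isNilpotent_e
    have hinj : Function.Injective (E ^ N) := by
      rw [End.coe_pow]
      exact (LinearMap.ker_eq_bot.1 hb).iterate N
    obtain ⟨v, hv⟩ := exists_ne (0 : V)
    exact hv (hinj (by simp [hN]))
  by_contra! hcon
  refine hker (eq_bot_iff.2 (t.ker_e_le.trans (iSup_le fun k v hv => ?_)))
  by_contra h0
  exact hcon v h0 hv.1 k (End.mem_eigenspace_iff.1 hv.2)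

/-- This replaces complete reducibility. A primitive vector of the quotient lifts to `v` with `E v`
in the span and of weight `j + 2` modulo its image under `E`, so `E v = E m` for some `m` in the
span. Then `v - m` is in the kernel of `E`, which the span contains. -/
theorem primitiveSpan_eq_top (t : IsSlTwoRep H E F) : primitiveSpan H E F = ⊤ := by
  by_contra hne
  have hnt : Nontrivial (V ⧸ primitiveSpan H E F) := Submodule.Quotient.nontrivial_iff.2 hne
  obtain ⟨q, hq0, hqE, j, hqH⟩ := (t.quotient _ t.primitiveSpan_le_h t.primitiveSpan_le_e
    primitiveSpan_le_f).exists_nat_eigenvector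
  obtain ⟨v, rfl⟩ := Submodule.Quotient.mk_surjective _ q
  set P := primitiveSpan H E F
  rw [Submodule.mapQ_apply, Submodule.Quotient.mk_eq_zero] at hqE
  rw [Submodule.mapQ_apply, ← sub_eq_zero, ← Submodule.Quotient.mk_smul,
    ← Submodule.Quotient.mk_sub, Submodule.Quotient.mk_eq_zero] at hqH
  obtain ⟨m, hm, hmv⟩ := t.mem_map_e_primitiveSpan hqE j (by
    refine ⟨_, hqH, ?_⟩
    rw [t.apply_he, map_sub, map_smul]
    module)
  apply hq0
  rw [Submodule.Quotient.mk_eq_zero]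
  have h1 : v - m ∈ LinearMap.ker E := by simp [hmv]
  have h2 : LinearMap.ker E ≤ P := t.ker_e_le.trans (iSup_le fun k x hx =>
    Submodule.subset_span ⟨x, k, 0, hx.1, End.mem_eigenspace_iff.1 hx.2, by simp⟩)
  simpa using P.add_mem (h2 h1) hm

theorem iSup_eigenspace_eq_top (t : IsSlTwoRep H E F) :
    ⨆ i : ℤ, H.eigenspace (i : K) = ⊤ := by
  rw [eq_top_iff, ← t.primitiveSpan_eq_top]
  refine Submodule.span_le.2 ?_
  rintro _ ⟨v, j, k, hv, hj, rfl⟩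
  refine Submodule.mem_iSup_of_mem ((j : ℤ) - 2 * k) (End.mem_eigenspace_iff.2 ?_)
  rw [t.apply_h_pow_f, hj, map_smul, ← sub_smul]
  push_cast
  rfl

/-- A highest weight vector in the image of `E` has positive weight. -/
theorem eq_zero_of_mem_ker_e (t : IsSlTwoRep H E F) {y : V} {i : ℤ} (hi : i ≤ 0)
    (hy : H y = ((i : K) - 2) • y) (hEy : E (E y) = 0) : E y = 0 := by
  by_contra h0
  have hEyH : H (E y) = (i : K) • E y := by rw [t.apply_he, hy, map_smul]; module
  obtain ⟨k, hk⟩ := t.exists_nat_of_mem_ker_e hEy h0 hEyH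
  obtain rfl : i = 0 := by
    have : i = k := by exact_mod_cast hk
    omega
  -- Only weight 0 remains. If `F (E y)` were nonzero it would be a primitive vector of weight `-2`.
  have hFE : F (E y) = 0 := by
    by_contra h1
    have h2 : E (F (E y)) = 0 := by rw [t.apply_ef, hEy, hEyH]; simp
    have h3 : H (F (E y)) = (-2 : K) • F (E y) := by rw [t.apply_hf, hEyH]; simp
    obtain ⟨k, hk⟩ := t.exists_nat_of_mem_ker_e h2 h1 h3
    have : (-2 : ℤ) = k := by exact_mod_cast hk
    omega
  have hH : ∀ k : ℕ, H ((F ^ k) y) = (-2 - 2 * k : K) • (F ^ k) y := fun k => by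
    rw [t.apply_h_pow_f, hy, map_smul]; push_cast; module
  -- With `F (E y) = 0`, the vector `y` behaves like a primitive vector of weight `-2`. The
  -- coefficients never vanish, so no `F ^ k y` does, contradicting nilpotency of `F`.
  have hEF : ∀ k : ℕ, E ((F ^ (k + 1)) y) = (-((k + 1) * (k + 2)) : K) • (F ^ k) y := by
    intro k
    induction k with
    | zero => simp [t.apply_ef, hFE, hy]
    | succ k ih =>
      rw [pow_succ', End.mul_apply, t.apply_ef, ih, hH, map_smul, ← End.mul_apply, ← pow_succ']
      push_cast
      module
  have hne : ∀ k : ℕ, (F ^ k) y ≠ 0 := by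
    intro k
    induction k with
    | zero => intro hy0; simp only [pow_zero, End.one_apply] at hy0; simp [hy0] at h0
    | succ k ih =>
      intro hk
      have h2 := hEF k
      rw [hk, map_zero, eq_comm, smul_eq_zero, neg_eq_zero, mul_eq_zero] at h2
      rcases h2 with (h2 | h2) | h2
      · exact absurd h2 (by exact_mod_cast k.succ_ne_zero)
      · exact absurd h2 (by exact_mod_cast (k + 1).succ_ne_zero)
      · exact ih h2
  obtain ⟨N, hN⟩ := t.isNilpotent_f
  exact hne N (by rw [hN, LinearMap.zero_apply])

end IsSlTwoRep

end SlTwo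

/-! ## Lie algebras graded by the adjoint action of an element -/

section GradedLie

open Module

/-- The span of the basis vectors of weight at least `i`. -/
def Module.Basis.geWeight {ι K V : Type*} [Field K] [AddCommGroup V] [Module K V]
    (b : Basis ι K V) (d : ι → ℤ) (i : ℤ) : Submodule K V where
  carrier := {x | ∀ k, d k < i → b.repr x k = 0}
  zero_mem' := by simp
  add_mem' := by
    intro x y hx hy k hk
    simp [hx k hk, hy k hk]
  smul_mem' := by
    intro c x hx k hk
    simp [hx k hk]

section Weights

variable {ι K V : Type*} [Field K] [AddCommGroup V] [Module K V] {b : Basis ι K V} {d : ι → ℤ}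

theorem Module.Basis.self_mem_geWeight {i : ℤ} {k : ι} (hk : i ≤ d k) : b k ∈ b.geWeight d i := by
  classical
  intro l hl
  rw [b.repr_self, Finsupp.single_apply, if_neg]
  rintro rfl
  omega

theorem Module.Basis.geWeight_anti {i j : ℤ} (h : i ≤ j) : b.geWeight d j ≤ b.geWeight d i :=
  fun _ hx k hk => hx k (hk.trans_le h)

theorem Module.Basis.geWeight_eq_span (i : ℤ) :
    b.geWeight d i = Submodule.span K (b '' {k | i ≤ d k}) := by
  refine le_antisymm (fun x hx => ?_) (Submodule.span_le.2 ?_)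
  · rw [b.mem_span_image]
    intro k hk
    by_contra hlt
    exact (Finsupp.mem_support_iff.1 hk) (hx k (not_le.1 hlt))
  · rintro _ ⟨k, hk, rfl⟩
    exact b.self_mem_geWeight hk

theorem Module.Basis.geWeight_induction {i : ℤ} {W : Submodule K V}
    (h : ∀ k, i ≤ d k → b k ∈ W) : b.geWeight d i ≤ W := by
  rw [b.geWeight_eq_span, Submodule.span_le]
  rintro _ ⟨k, hk, rfl⟩
  exact h k hk

end Weights

variable {ι K L : Type*} [Field K] [LieRing L] [LieAlgebra K L]
  {b : Basis ι K L} {d : ι → ℤ} {h : L}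

theorem repr_lie_eigenbasis (hb : ∀ k, ⁅h, b k⁆ = (d k : K) • b k) (x : L) (k : ι) :
    b.repr ⁅h, x⁆ k = (d k : K) * b.repr x k := by
  classical
  have : (b.coord k) ∘ₗ (LieAlgebra.ad K L h : L →ₗ[K] L) = (d k : K) • b.coord k := by
    refine b.ext fun l => ?_
    simp only [LinearMap.comp_apply, LieAlgebra.ad_apply, hb, map_smul, LinearMap.smul_apply,
      Basis.coord_apply, b.repr_self, Finsupp.single_apply]
    split_ifs with hlk
    · rw [hlk]
    · simp
  exact LinearMap.congr_fun this x

theorem lie_basis_eigenbasis (hb : ∀ k, ⁅h, b k⁆ = (d k : K) • b k) (k l : ι) :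
    ⁅h, ⁅b k, b l⁆⁆ = ((d k + d l : ℤ) : K) • ⁅b k, b l⁆ := by
  rw [leibniz_lie, hb, hb, smul_lie, lie_smul, ← add_smul]
  push_cast
  rfl

theorem weight_eq_of_repr_ne_zero (hb : ∀ k, ⁅h, b k⁆ = (d k : K) • b k) {x : L} {c : K}
    (hx : ⁅h, x⁆ = c • x) {k : ι} (hk : b.repr x k ≠ 0) : (d k : K) = c := by
  have h1 := repr_lie_eigenbasis hb x k
  rw [hx, map_smul, Finsupp.smul_apply, smul_eq_mul] at h1
  exact (mul_right_cancel₀ hk h1).symm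

theorem lie_mem_geWeight [CharZero K] (hb : ∀ k, ⁅h, b k⁆ = (d k : K) • b k) {i j : ℤ} {x y : L}
    (hx : x ∈ b.geWeight d i) (hy : y ∈ b.geWeight d j) : ⁅x, y⁆ ∈ b.geWeight d (i + j) := by
  have h1 : ∀ k, i ≤ d k → ∀ l, j ≤ d l → ⁅b k, b l⁆ ∈ b.geWeight d (i + j) := by
    intro k hk l hl m hm
    by_contra h0
    have h2 : (d m : K) = _ := weight_eq_of_repr_ne_zero hb (lie_basis_eigenbasis hb k l) h0
    have : d m = d k + d l := by exact_mod_cast h2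
    omega
  have h2 : ∀ k, i ≤ d k → ⁅b k, y⁆ ∈ b.geWeight d (i + j) := by
    intro k hk
    exact (b.geWeight_induction (W := (b.geWeight d (i + j)).comap
      (LieAlgebra.ad K L (b k) : L →ₗ[K] L)) fun l hl => h1 k hk l hl) hy
  have h3 := (b.geWeight_induction (W := (b.geWeight d (i + j)).comap
      (LieAlgebra.ad K L y : L →ₗ[K] L)) fun k hk => by
        rw [Submodule.mem_comap, LieAlgebra.ad_apply, ← lie_skew]
        exact Submodule.neg_mem _ (h2 k hk)) hx
  rw [Submodule.mem_comap, LieAlgebra.ad_apply, ← lie_skew] at h3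
  exact (Submodule.neg_mem_iff _).1 h3

theorem killingForm_eigenbasis_self [Fintype ι] (hb : ∀ k, ⁅h, b k⁆ = (d k : K) • b k) :
    killingForm K L h h = ∑ k, (d k : K) ^ 2 := by
  classical
  rw [killingForm_apply_apply, LinearMap.trace_eq_matrix_trace K b, Matrix.trace]
  refine Finset.sum_congr rfl fun k _ => ?_
  rw [Matrix.diag_apply, LinearMap.toMatrix_apply]
  simp [hb, sq]

/-- Invariance under `ad h` multiplies the pairing by the total weight and gives zero. -/
theorem killingForm_basis_eq_zero [CharZero K] (hb : ∀ k, ⁅h, b k⁆ = (d k : K) • b k) {k l : ι}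
    (hkl : d k + d l ≠ 0) : killingForm K L (b k) (b l) = 0 := by
  have h1 := LieModule.traceForm_apply_lie_apply K L L (b k) h (b l)
  rw [hb, ← lie_skew, hb] at h1
  change killingForm K L _ _ = killingForm K L _ _ at h1
  simp only [map_neg, map_smul, LinearMap.neg_apply, LinearMap.smul_apply, smul_eq_mul] at h1
  have h2 : ((d k + d l : ℤ) : K) * killingForm K L (b k) (b l) = 0 := by
    push_cast
    linear_combination -h1
  exact (mul_eq_zero.1 h2).resolve_left (by exact_mod_cast hkl)

/-- The negative part `z` of `y` pairs with vectors of positive weight as `y` does, that is to zero,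
and with vectors of weight at most 0 to zero by the grading. Nondegeneracy forces `z = 0`. -/
theorem mem_geWeight_zero_of_killingForm [CharZero K] [Fintype ι] (hb : ∀ k, ⁅h, b k⁆ = (d k : K) • b k)
    (hnd : ∀ x : L, (∀ y, killingForm K L x y = 0) → x = 0) {y : L}
    (hy : ∀ x ∈ b.geWeight d 1, killingForm K L y x = 0) : y ∈ b.geWeight d 0 := by
  classical
  set z : L := ∑ k, (if d k < 0 then b.repr y k else 0) • b k with hz
  have hzk : ∀ k, b.repr z k = if d k < 0 then b.repr y k else 0 := by
    exact fun k => congrFun (b.repr_sum_self fun k => if d k < 0 then b.repr y k else 0) k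
  have hexp : ∀ (x : L) (l : ι), killingForm K L x (b l) =
      ∑ k, b.repr x k * killingForm K L (b k) (b l) := by
    intro x l
    have := congrArg ((killingForm K L).flip (b l)) (b.sum_repr x).symm
    simp only [map_sum, map_smul, smul_eq_mul] at this
    exact this
  have hz0 : z = 0 := by
    refine hnd z fun x => ?_
    rw [← b.sum_repr x, map_sum]
    refine Finset.sum_eq_zero fun l _ => ?_
    rw [map_smul]
    suffices killingForm K L z (b l) = 0 by simp [this]
    by_cases hl : 1 ≤ d l
    · rw [← hy (b l) (b.self_mem_geWeight hl), hexp, hexp]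
      refine Finset.sum_congr rfl fun k _ => ?_
      rw [hzk]
      split_ifs with hk
      · rfl
      · rw [killingForm_basis_eq_zero hb (by omega)]; simp
    · rw [hexp]
      refine Finset.sum_eq_zero fun k _ => ?_
      rw [hzk]
      split_ifs with hk
      · rw [killingForm_basis_eq_zero hb (by omega)]; simp
      · simp
  intro k hk
  have := hzk k
  rw [hz0, if_pos hk] at this
  simpa using this.symm

/-- The radical is an ideal, and one element with nonzero self-pairing excludes that it is
everything. Cartan's criterion is not needed, since `h` serves as this element. -/
theorem killingForm_nondegenerate_of_isSimple (hs : LieAlgebra.IsSimple K L) {x : L}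
    (hx : killingForm K L x x ≠ 0) (y : L) (hy : ∀ z, killingForm K L y z = 0) : y = 0 := by
  have h1 : y ∈ LieIdeal.killingCompl K L ⊤ := by
    rw [LieIdeal.mem_killingCompl]
    intro z _
    rw [LieModule.traceForm_comm]
    exact hy z
  rcases hs.eq_bot_or_eq_top (LieIdeal.killingCompl K L ⊤) with h | h
  · rw [h] at h1
    simpa using h1
  · have h2 : x ∈ LieIdeal.killingCompl K L ⊤ := by rw [h]; exact LieSubmodule.mem_top x
    exact absurd ((LieIdeal.mem_killingCompl K L ⊤).1 h2 x (LieSubmodule.mem_top x)) hx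

end GradedLie

/-! ### Weights of a standard triple in the adjoint representation. -/

section Triples

open Module

variable {K L : Type*} [Field K] [LieRing L] [LieAlgebra K L] {h e f : L}

theorem IsStandardTriple.isSlTwoRep (t : IsStandardTriple h e f) :
    IsSlTwoRep (K := K) (LieAlgebra.ad K L h : End K L) (LieAlgebra.ad K L e)
      (LieAlgebra.ad K L f) := by
  refine ⟨LinearMap.ext fun x => ?_, LinearMap.ext fun x => ?_, LinearMap.ext fun x => ?_⟩
  · have := lie_lie h e x
    rw [t.lie_h_e, two_nsmul, add_lie] at this
    simp only [LinearMap.sub_apply, End.mul_apply, LieAlgebra.ad_apply, 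
      two_smul]
    exact this.symm
  · have := lie_lie h f x
    rw [t.lie_h_f, two_nsmul, neg_lie, add_lie] at this
    simp only [LinearMap.sub_apply, End.mul_apply, LieAlgebra.ad_apply,
      neg_smul, two_smul, LinearMap.neg_apply]
    exact this.symm
  · have := lie_lie e f x
    rw [t.lie_e_f] at this
    simp only [LinearMap.sub_apply, End.mul_apply, LieAlgebra.ad_apply]
    exact this.symm

theorem IsStandardTriple.exists_eigenbasis [CharZero K] [FiniteDimensional K L]
    (t : IsStandardTriple h e f) :
    ∃ (b : Basis (Fin (finrank K L)) K L) (d : Fin (finrank K L) → ℤ),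
      ∀ k, ⁅h, b k⁆ = (d k : K) • b k := by
  obtain ⟨s, hs, hspan, hli⟩ := exists_linearIndependent K {x : L | ∃ i : ℤ, ⁅h, x⁆ = (i : K) • x}
  have htop : ⊤ ≤ Submodule.span K s := by
    rw [hspan, ← (t.isSlTwoRep (K := K)).iSup_eigenspace_eq_top]
    refine iSup_le fun i x hx => Submodule.subset_span ⟨i, ?_⟩
    exact End.mem_eigenspace_iff.1 hx
  let b₀ : Basis s K L := Basis.mk hli (by simpa using htop)
  have : Finite s := Module.Finite.finite_basis b₀
  have : Fintype s := Fintype.ofFinite s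
  let eq : s ≃ Fin (finrank K L) := Fintype.equivFinOfCardEq (finrank_eq_card_basis b₀).symm
  choose d hd using fun x : s => hs x.2
  refine ⟨b₀.reindex eq, fun k => d (eq.symm k), fun k => ?_⟩
  rw [Basis.reindex_apply]
  simpa [b₀] using hd (eq.symm k)

/-- Two standard triples with the same nilpositive element have neutral elements that agree
modulo the positive weight spaces. -/
theorem IsStandardTriple.sub_mem_geWeight [CharZero K] [FiniteDimensional K L] {ι : Type*}
    [Fintype ι] {b : Basis ι K L} {d : ι → ℤ} (hb : ∀ k, ⁅h, b k⁆ = (d k : K) • b k)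
    (t : IsStandardTriple h e f) {h' f' : L} (t' : IsStandardTriple h' e f') :
    h' - h ∈ b.geWeight d 1 := by
  classical
  -- The projection onto the weight space of weight `i`.
  let c : ℤ → L →ₗ[K] L := fun i => b.constr K fun k => if d k = i then b k else 0
  have hc : ∀ i k, c i (b k) = if d k = i then b k else 0 := fun i k => b.constr_basis K _ k
  have hrepr : ∀ i x k, b.repr (c i x) k = if d k = i then b.repr x k else 0 := by
    intro i x k
    have : b.coord k ∘ₗ c i = (if d k = i then (1 : K) else 0) • b.coord k := by
      refine b.ext fun l => ?_
      rw [LinearMap.comp_apply, hc]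
      by_cases hl : d l = i <;> by_cases hlk : l = k <;> by_cases hk : d k = i <;>
        simp_all
    have := LinearMap.congr_fun this x
    rw [LinearMap.comp_apply, Basis.coord_apply, LinearMap.smul_apply, Basis.coord_apply] at this
    rw [this]
    split_ifs <;> simp
  have hcH : ∀ i x, ⁅h, c i x⁆ = (i : K) • c i x := by
    intro i x
    refine b.repr.injective (Finsupp.ext fun k => ?_)
    rw [repr_lie_eigenbasis hb, map_smul, Finsupp.smul_apply, hrepr, smul_eq_mul]
    split_ifs with hk
    · rw [hk]
    · simp
  have hce : ∀ i x, ⁅e, c i x⁆ = c (i + 2) ⁅e, x⁆ := by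
    intro i x
    have : (LieAlgebra.ad K L e : L →ₗ[K] L) ∘ₗ c i =
        c (i + 2) ∘ₗ (LieAlgebra.ad K L e : L →ₗ[K] L) := by
      refine b.ext fun k => ?_
      simp only [LinearMap.comp_apply, LieAlgebra.ad_apply, hc]
      have hw : ⁅h, ⁅e, b k⁆⁆ = ((d k + 2 : ℤ) : K) • ⁅e, b k⁆ := by
        rw [leibniz_lie, t.lie_h_e, hb, two_nsmul, add_lie, lie_smul]
        push_cast
        module
      refine b.repr.injective (Finsupp.ext fun m => ?_)
      rw [hrepr]
      by_cases hm : b.repr ⁅e, b k⁆ m = 0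
      · split_ifs <;> simp [hm]
      · have h2 : d m = d k + 2 := by exact_mod_cast weight_eq_of_repr_ne_zero hb hw hm
        by_cases hk : d k = i
        · simp [hk, h2]
        · rw [if_neg hk, if_neg (by omega)]; simp
    exact LinearMap.congr_fun this x
  have hx : h' - h = ⁅e, f' - f⁆ := by rw [lie_sub, t.lie_e_f, t'.lie_e_f]
  have hex : ⁅e, h' - h⁆ = 0 := by
    rw [lie_sub, ← lie_skew, ← lie_skew e h, t.lie_h_e, t'.lie_h_e, sub_self]
  intro k hk
  -- The difference `h' - h = ⁅e, f' - f⁆` lies in both the image and the kernel of `ad e`, and so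
  -- does each weight component. In weight at most 0 such a component vanishes.
  have hkey : c (d k) (h' - h) = 0 := by
    have h1 : c (d k) (h' - h) = ⁅e, c (d k - 2) (f' - f)⁆ := by
      rw [hce, hx]; congr 2; ring
    rw [h1]
    refine (t.isSlTwoRep (K := K)).eq_zero_of_mem_ker_e (i := d k) (by omega) ?_ ?_
    · rw [LieAlgebra.ad_apply, hcH]; push_cast; rfl
    · rw [LieAlgebra.ad_apply, LieAlgebra.ad_apply, ← h1, hce, hex, map_zero]
  have := hrepr (d k) (h' - h) k
  rw [hkey, if_pos rfl] at this
  simpa using this.symm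

end Triples

/-! ## Bounded representatives of the orbit of a grading element -/

section BoundedRepresentatives

open Module

/-- Both sides are the trace of `T` restricted to `S`. This lets a translated weight projection,
whose norm is uncontrolled, be traded for an orthogonal one. -/
theorem LinearMap.trace_mul_eq_of_projections {K V : Type*} [Field K] [AddCommGroup V] [Module K V]
    (S : Submodule K V) (T q q' : End K V) (hT : ∀ x ∈ S, T x ∈ S) (hq : ∀ x, q x ∈ S)
    (hq' : ∀ x, q' x ∈ S) (hqS : ∀ x ∈ S, q x = x) (hqS' : ∀ x ∈ S, q' x = x) :
    LinearMap.trace K V (T * q) = LinearMap.trace K V (T * q') := by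
  have h1 : T * q = q' * (T * q) := LinearMap.ext fun x => by
    simp [hqS' _ (hT _ (hq x))]
  have h2 : q * q' = q' := LinearMap.ext fun x => by simp [hqS _ (hq' x)]
  rw [h1, LinearMap.trace_mul_comm, mul_assoc, h2]

variable {𝕜 L ι : Type*} [RCLike 𝕜] [LieRing L] [LieAlgebra 𝕜 L]
  {b : Basis ι 𝕜 L} {d : ι → ℤ} {h : L}

/-- A weight `m` with `|m| ≤ N` is the number of integers in `(-N, m]`, less `N`. Thus `ad h` is
expressed through projections onto the steps of the weight filtration. -/
theorem ad_eq_sum_sub (hb : ∀ k, ⁅h, b k⁆ = (d k : 𝕜) • b k) (N : ℕ)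
    (hN : ∀ k, |d k| ≤ N) :
    (LieAlgebra.ad 𝕜 L h : End 𝕜 L) =
      ∑ i ∈ Finset.Ioc (-(N : ℤ)) N, b.constr 𝕜 (fun k => if i ≤ d k then b k else 0) -
        (N : 𝕜) • (1 : End 𝕜 L) := by
  refine b.ext fun k => ?_
  rw [LieAlgebra.ad_apply, hb, LinearMap.sub_apply, LinearMap.sum_apply]
  simp only [Basis.constr_basis, LinearMap.smul_apply, End.one_apply]
  rw [← Finset.sum_filter, Finset.sum_const, ← sub_eq_zero]
  have h1 : (Finset.Ioc (-(N : ℤ)) N).filter (fun i => i ≤ d k) = Finset.Ioc (-(N : ℤ)) (d k) := by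
    ext i
    have := (abs_le.1 (hN k)).2
    simp only [Finset.mem_filter, Finset.mem_Ioc]
    constructor
    · exact fun h => ⟨h.1.1, h.2⟩
    · exact fun h => ⟨⟨h.1, h.2.trans this⟩, h.2⟩
  have h2 : (((Finset.Ioc (-(N : ℤ)) (d k)).card : ℤ) : 𝕜) = (d k + N : 𝕜) := by
    have := (abs_le.1 (hN k)).1
    rw [Int.card_Ioc, Int.toNat_of_nonneg (by omega)]
    push_cast
    ring
  rw [h1, ← Nat.cast_smul_eq_nsmul 𝕜, ← Int.cast_natCast, h2]
  module

theorem le_of_sq_le_mul {w A t a T c : ℝ} (hw : 0 ≤ w) (ht : 0 ≤ t) (ha : 0 ≤ a) (hT : 0 ≤ T)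
    (hc : 0 ≤ c) (h : w ^ 2 ≤ c * (t * A)) (hA : A ≤ a * (T * w)) : w ≤ c * (t * a) * T := by
  rcases hw.eq_or_lt with rfl | h0
  · positivity
  · refine le_of_mul_le_mul_right ?_ h0
    calc w * w = w ^ 2 := (sq w).symm
      _ ≤ c * (t * (a * (T * w))) := h.trans (by gcongr)
      _ = _ := by ring

set_option maxHeartbeats 1000000 in
/-- A quantitative form of the compactness of the variety of parabolic subalgebras: every
translate of `h + u` under an automorphism contains a representative of bounded size. -/
theorem exists_bounded_representative [Fintype ι] (hb : ∀ k, ⁅h, b k⁆ = (d k : 𝕜) • b k)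
    (hnd : ∀ x : L, (∀ y, killingForm 𝕜 L x y = 0) → x = 0)
    {n : ℕ} (ψ : L ≃ₗ[𝕜] EuclideanSpace 𝕜 (Fin n)) :
    ∃ C : ℝ, ∀ γ : L ≃ₗ⁅𝕜⁆ L, ∃ a : L, ‖ψ a‖ ≤ C ∧
      ∃ x ∈ b.geWeight d 1, γ h = a + γ x := by
  classical
  have : FiniteDimensional 𝕜 L := Module.Finite.of_basis b
  let E := EuclideanSpace 𝕜 (Fin n)
  -- the vector representing a functional through the Killing form
  let κ : L →ₗ[𝕜] Dual 𝕜 L := killingForm 𝕜 L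
  have hκ : Function.Injective κ := by
    rw [← LinearMap.ker_eq_bot, LinearMap.ker_eq_bot']
    exact fun x hx => hnd x fun y => LinearMap.congr_fun hx y
  let κe : L ≃ₗ[𝕜] Dual 𝕜 L := LinearEquiv.ofInjectiveOfFinrankEq κ hκ
    (Subspace.dual_finrank_eq (K := 𝕜) (V := L)).symm
  have hκe : ∀ x y, κe x y = killingForm 𝕜 L x y := fun x y => rfl
  let T : (E →L[𝕜] 𝕜) →ₗ[𝕜] E :=
    { toFun := fun ℓ => ψ (κe.symm ((ℓ : E →ₗ[𝕜] 𝕜) ∘ₗ ψ.toLinearMap))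
      map_add' := fun ℓ ℓ' => by
        rw [← map_add, ← map_add]; rfl
      map_smul' := fun c ℓ => by
        rw [RingHom.id_apply, ← map_smul, ← map_smul]; rfl }
  let T' := T.toContinuousLinearMap
  -- the adjoint action in coordinates
  let α : E →ₗ[𝕜] (E →L[𝕜] E) := (LinearMap.toContinuousLinearMap.toLinearMap :
      (E →ₗ[𝕜] E) →ₗ[𝕜] (E →L[𝕜] E)) ∘ₗ (ψ.conj.toLinearMap : End 𝕜 L →ₗ[𝕜] End 𝕜 E) ∘ₗ
      (LieAlgebra.ad 𝕜 L : L →ₗ[𝕜] End 𝕜 L) ∘ₗ ψ.symm.toLinearMap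
  have hα : ∀ x, (α (ψ x) : E →ₗ[𝕜] E) = ψ.conj (LieAlgebra.ad 𝕜 L x) := fun x => by
    ext y; simp [α]
  let α' := α.toContinuousLinearMap
  let tr : (E →L[𝕜] E) →ₗ[𝕜] 𝕜 := LinearMap.trace 𝕜 E ∘ₗ
    (LinearMap.toContinuousLinearMap.symm.toLinearMap : (E →L[𝕜] E) →ₗ[𝕜] (E →ₗ[𝕜] E))
  let tr' := tr.toContinuousLinearMap
  obtain ⟨N, hN⟩ : ∃ N : ℕ, ∀ k, |d k| ≤ N := by
    refine ⟨∑ k, (d k).natAbs, fun k => ?_⟩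
    rw [Int.abs_eq_natAbs]
    exact_mod_cast Finset.single_le_sum (f := fun k => (d k).natAbs) (fun _ _ => Nat.zero_le _)
      (Finset.mem_univ k)
  refine ⟨((Finset.Ioc (-(N : ℤ)) N).card + N) * (‖tr'‖ * ‖α'‖) * ‖T'‖, fun γ => ?_⟩
  let γl : L →ₗ[𝕜] L := γ.toLinearEquiv.toLinearMap
  let S : ℤ → Submodule 𝕜 E := fun i => (b.geWeight d i).map (ψ.toLinearMap ∘ₗ γl)
  have hS : ∀ i y, ψ y ∈ S i ↔ γ.symm y ∈ b.geWeight d i := by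
    intro i y
    constructor
    · rintro ⟨x, hx, hxy⟩
      have : γ x = y := ψ.injective hxy
      rw [← this]
      simpa using hx
    · exact fun hy => ⟨_, hy, by simp [γl]⟩
  let P : ℤ → E →L[𝕜] E := fun i => (S i).starProjection
  -- The shortest vector of the translate of `h + u`, in coordinates.
  let w : E := ψ (γ h) - P 1 (ψ (γ h))
  let a : L := ψ.symm w
  -- The Killing dual of the functional given by the inner product with `w`; its size is linear in
  -- that of `w`.
  let s : L := ψ.symm (T (innerSL 𝕜 w))
  have hs : ∀ y, killingForm 𝕜 L s y = inner 𝕜 w (ψ y) := by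
    intro y
    rw [← hκe]
    simp [s, T]
  let v : L := γ.symm s
  have hγs : γ v = s := by simp [v]
  have hworth : ∀ y, y ∈ S 1 → inner 𝕜 w y = 0 := fun y hy =>
    Submodule.inner_left_of_mem_orthogonal hy
      (Submodule.sub_starProjection_mem_orthogonal (K := S 1) (ψ (γ h)))
  have hkγ : ∀ x y, killingForm 𝕜 L (γ x) (γ y) = killingForm 𝕜 L x y := fun x y =>
    LieAlgebra.killingForm_of_equiv_apply γ x y
  -- As `w` is orthogonal to the translated nilradical, `s` is Killing-orthogonal to it. So `v` has
  -- weights at least 0, and `ad s` preserves every `S i`.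
  have hv : v ∈ b.geWeight d 0 := by
    refine mem_geWeight_zero_of_killingForm hb hnd fun x hx => ?_
    rw [← hkγ, hγs, hs]
    exact hworth _ ((hS 1 _).2 (by simpa using hx))
  have hbound1 : ‖T (innerSL 𝕜 w)‖ ≤ ‖T'‖ * ‖w‖ := by
    have := T'.le_opNorm (innerSL 𝕜 w)
    rwa [innerSL_apply_norm] at this
  have hxw : ∃ x ∈ b.geWeight d 1, γ h = a + γ x := by
    have h1 : P 1 (ψ (γ h)) ∈ S 1 := Submodule.starProjection_apply_mem _ _
    obtain ⟨x, hx, hx'⟩ := h1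
    refine ⟨x, hx, ψ.injective ?_⟩
    have : ψ (γ x) = P 1 (ψ (γ h)) := hx'
    rw [map_add, this]
    simp [a, w]
  refine ⟨a, ?_, hxw⟩
  have hnorm : (‖w‖ : 𝕜) ^ 2 = killingForm 𝕜 L v h := by
    rw [← inner_self_eq_norm_sq_to_K (𝕜 := 𝕜), ← hkγ, hγs, hs]
    conv_rhs => rw [show ψ (γ h) = w + P 1 (ψ (γ h)) by simp [w]]
    rw [inner_add_right, hworth _ (Submodule.starProjection_apply_mem _ _), add_zero]
  have htr1 : ∀ i, LinearMap.trace 𝕜 L ((LieAlgebra.ad 𝕜 L v : End 𝕜 L) *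
      b.constr 𝕜 (fun k => if i ≤ d k then b k else 0)) =
        tr (α (T (innerSL 𝕜 w)) ∘L P i) := by
    intro i
    let φ : L ≃ₗ[𝕜] E := γ.toLinearEquiv.trans ψ
    have hφ : ∀ x, φ x = ψ (γ x) := fun x => rfl
    have hφsymm : ∀ x, φ.symm x = γ.symm (ψ.symm x) := fun x => rfl
    let q : End 𝕜 L := b.constr 𝕜 (fun k => if i ≤ d k then b k else 0)
    have hqk : ∀ k, q (b k) = if i ≤ d k then b k else 0 := fun k => b.constr_basis 𝕜 _ k
    have hqmem : ∀ x, q x ∈ b.geWeight d i := by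
      have : (⊤ : Submodule 𝕜 L) ≤ (b.geWeight d i).comap q := by
        rw [← b.span_eq, Submodule.span_le]
        rintro _ ⟨k, rfl⟩
        simp only [Submodule.comap_coe, Set.mem_preimage, SetLike.mem_coe, hqk]
        split_ifs with hk
        · exact b.self_mem_geWeight hk
        · exact Submodule.zero_mem _
      exact fun x => this Submodule.mem_top
    have hqid : ∀ x ∈ b.geWeight d i, q x = x := by
      intro x hx
      have := b.geWeight_induction (W := LinearMap.eqLocus q LinearMap.id) (d := d) (i := i)
        (fun k hk => by rw [LinearMap.mem_eqLocus, hqk, if_pos hk]; rfl)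
      exact this hx
    have h1 : LinearMap.trace 𝕜 L ((LieAlgebra.ad 𝕜 L v : End 𝕜 L) * q) =
        LinearMap.trace 𝕜 E (ψ.conj (LieAlgebra.ad 𝕜 L s) * φ.conj q) := by
      rw [← LinearMap.trace_conj' _ φ]
      congr 1
      refine LinearMap.ext fun y => ?_
      simp only [LinearEquiv.conj_apply, LinearMap.comp_apply, LinearEquiv.coe_coe, hφ, hφsymm,
        Module.End.mul_apply, LieAlgebra.ad_apply, LinearEquiv.symm_apply_apply]
      rw [LieEquiv.map_lie, hγs]
    have h2 : tr (α (T (innerSL 𝕜 w)) ∘L P i) =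
        LinearMap.trace 𝕜 E (ψ.conj (LieAlgebra.ad 𝕜 L s) * (P i : E →ₗ[𝕜] E)) := by
      have : T (innerSL 𝕜 w) = ψ s := by simp [s]
      rw [← hα s, this]
      rfl
    rw [h1, h2]
    refine LinearMap.trace_mul_eq_of_projections (S i) _ _ _ ?_ ?_ ?_ ?_ ?_
    · intro x hx
      obtain ⟨y, rfl⟩ := ψ.surjective x
      rw [LinearEquiv.conj_apply]
      simp only [LinearMap.comp_apply, LinearEquiv.coe_coe, LinearEquiv.symm_apply_apply,
        LieAlgebra.ad_apply]
      rw [hS] at hx ⊢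
      rw [LieEquiv.map_lie]
      simpa using lie_mem_geWeight hb hv hx
    · intro x
      obtain ⟨y, rfl⟩ := φ.surjective x
      rw [LinearEquiv.conj_apply]
      simp only [LinearMap.comp_apply, LinearEquiv.coe_coe, LinearEquiv.symm_apply_apply]
      rw [hφ, hS]
      simpa using hqmem y
    · exact fun x => Submodule.starProjection_apply_mem _ _
    · intro x hx
      obtain ⟨y, rfl⟩ := φ.surjective x
      rw [hφ, hS] at hx
      rw [LinearEquiv.conj_apply]
      simp only [LinearMap.comp_apply, LinearEquiv.coe_coe, LinearEquiv.symm_apply_apply]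
      rw [hqid y (by simpa using hx)]
    · exact fun x hx => Submodule.starProjection_eq_self_iff.2 hx
  have htr2 : LinearMap.trace 𝕜 L (LieAlgebra.ad 𝕜 L v) = tr (α (T (innerSL 𝕜 w))) := by
    have : T (innerSL 𝕜 w) = ψ s := by simp [s]
    have h2 : tr (α (ψ s)) = LinearMap.trace 𝕜 E (ψ.conj (LieAlgebra.ad 𝕜 L s)) := by
      rw [← hα s]; rfl
    rw [this, h2, LinearMap.trace_conj', ← hγs, ← LinearMap.trace_conj' _ γ.toLinearEquiv]
    congr 1
    refine LinearMap.ext fun y => ?_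
    simp only [LinearEquiv.conj_apply, LinearMap.comp_apply, LinearEquiv.coe_coe,
      LieAlgebra.ad_apply]
    exact (LieEquiv.map_lie γ v _).trans
      (congrArg (⁅γ v, ·⁆) (γ.toLinearEquiv.apply_symm_apply y))
  have hval : killingForm 𝕜 L v h =
      ∑ i ∈ Finset.Ioc (-(N : ℤ)) N, tr (α (T (innerSL 𝕜 w)) ∘L P i) -
        N * tr (α (T (innerSL 𝕜 w))) := by
    rw [killingForm_apply_apply, ad_eq_sum_sub hb N hN, ← Module.End.mul_eq_comp, mul_sub,
      Finset.mul_sum, map_sub, map_sum, mul_smul_comm, mul_one, map_smul, htr2, smul_eq_mul]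
    congr 1
    exact Finset.sum_congr rfl fun i _ => htr1 i
  set A := α (T (innerSL 𝕜 w)) with hA
  have hAnorm : ‖A‖ ≤ ‖α'‖ * (‖T'‖ * ‖w‖) :=
    (α'.le_opNorm _).trans (mul_le_mul_of_nonneg_left hbound1 (norm_nonneg α'))
  have htrn : ∀ X : E →L[𝕜] E, ‖tr X‖ ≤ ‖tr'‖ * ‖X‖ := fun X => tr'.le_opNorm X
  have hP : ∀ i, ‖tr (A ∘L P i)‖ ≤ ‖tr'‖ * ‖A‖ := by
    intro i
    refine (htrn _).trans (mul_le_mul_of_nonneg_left ?_ (norm_nonneg tr'))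
    refine (ContinuousLinearMap.opNorm_comp_le _ _).trans ?_
    exact mul_le_of_le_one_right (norm_nonneg A) (Submodule.starProjection_norm_le _)
  -- Orthogonal projections have norm at most 1, whatever `γ` is, and the extra `N` comes from the
  -- scalar term of `ad h`. Since `‖A‖` is linear in `‖w‖`, one factor cancels.
  have hfin : ‖w‖ ^ 2 ≤ ((Finset.Ioc (-(N : ℤ)) N).card + N) * (‖tr'‖ * ‖A‖) := by
    have h1 : ‖w‖ ^ 2 = ‖killingForm 𝕜 L v h‖ := by
      rw [← hnorm, norm_pow, RCLike.norm_ofReal, abs_norm]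
    rw [h1, hval, add_mul]
    refine (norm_sub_le _ _).trans (add_le_add ?_ ?_)
    · refine (norm_sum_le _ _).trans ?_
      refine (Finset.sum_le_sum fun i _ => hP i).trans ?_
      rw [Finset.sum_const, nsmul_eq_mul]
    · rw [norm_mul, RCLike.norm_natCast]
      exact mul_le_mul_of_nonneg_left (htrn _) (Nat.cast_nonneg _)
  have haw : ψ a = w := by simp [a]
  rw [haw]
  exact le_of_sq_le_mul (norm_nonneg w) (norm_nonneg tr') (norm_nonneg α') (norm_nonneg T')
    (add_nonneg (Nat.cast_nonneg _) (Nat.cast_nonneg _)) hfin hAnorm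

end BoundedRepresentatives

/-! ## Conjugation by exponentials -/

section ConjExp

open NormedSpace Topology Filter

variable {A : Type*} [NormedRing A] [NormedAlgebra ℝ A]

/-- The commutator with `y`. -/
noncomputable def commutatorCLM (y : A) : A →L[ℝ] A :=
  ContinuousLinearMap.mul ℝ A y - (ContinuousLinearMap.mul ℝ A).flip y

theorem commutatorCLM_apply (y v : A) : commutatorCLM y v = y * v - v * y := rfl

variable [CompleteSpace A]

theorem exp_mul_exp_neg_self (y : A) : exp y * exp (-y) = 1 := by
  let _ : NormedAlgebra ℚ A := NormedAlgebra.restrictScalars ℚ ℝ A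
  rw [← exp_add_of_commute (Commute.neg_right (Commute.refl y)), add_neg_cancel, exp_zero]

theorem Units.inv_eq_exp_neg {g : Aˣ} {y : A} (hg : (g : A) = exp y) :
    ((g⁻¹ : Aˣ) : A) = exp (-y) := by
  rw [Units.inv_eq_of_mul_eq_one_right]
  rw [hg, exp_mul_exp_neg_self]

theorem exists_unit_eq_exp (y : A) : ∃ g : Aˣ, (g : A) = exp y := by
  let _ : NormedAlgebra ℚ A := NormedAlgebra.restrictScalars ℚ ℝ A
  exact isUnit_exp y

/-- Left and right multiplication by `y` commute, so the exponential of the commutator is the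
product of the exponentials of left multiplication and negated right multiplication. -/
theorem hasSum_conj_exp (y v : A) :
    HasSum (fun k : ℕ => ((k.factorial : ℝ)⁻¹) • (commutatorCLM y ^ k) v)
      (exp y * v * exp (-y)) := by
  let _ : NormedAlgebra ℚ A := NormedAlgebra.restrictScalars ℚ ℝ A
  let _ : NormedAlgebra ℚ (A →L[ℝ] A) := NormedAlgebra.restrictScalars ℚ ℝ (A →L[ℝ] A)
  have h0 : ∀ (T : A →L[ℝ] A) (w : A),
      HasSum (fun k : ℕ => ((k.factorial : ℝ)⁻¹) • (T ^ k) w) (exp T w) := fun T w =>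
    (exp_series_hasSum_exp' (𝕂 := ℝ) T).mapL (ContinuousLinearMap.apply ℝ A w)
  have hl : ∀ w, exp (ContinuousLinearMap.mul ℝ A y) w = exp y * w := by
    intro w
    refine (h0 _ w).unique ?_
    have h1 := (exp_series_hasSum_exp' (𝕂 := ℝ) y).mul_right w
    refine h1.congr_fun fun k => ?_
    have : ∀ k : ℕ, (ContinuousLinearMap.mul ℝ A y ^ k) w = y ^ k * w := by
      intro k
      induction k with
      | zero => simp
      | succ k ih =>
        rw [pow_succ', pow_succ', mul_apply_eq_comp, ih,
          ContinuousLinearMap.mul_apply', mul_assoc]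
    rw [this, smul_mul_assoc]
  have hr : ∀ w, exp (-(ContinuousLinearMap.mul ℝ A).flip y) w = w * exp (-y) := by
    intro w
    refine (h0 _ w).unique ?_
    have h1 := (exp_series_hasSum_exp' (𝕂 := ℝ) (-y)).mul_left w
    refine h1.congr_fun fun k => ?_
    have : ∀ k : ℕ, ((-(ContinuousLinearMap.mul ℝ A).flip y) ^ k) w = w * (-y) ^ k := by
      intro k
      induction k with
      | zero => simp
      | succ k ih =>
        rw [pow_succ', pow_succ, mul_apply_eq_comp, ih]
        simp [mul_assoc]
    rw [this, mul_smul_comm]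
  have hcomm : Commute (ContinuousLinearMap.mul ℝ A y) (-(ContinuousLinearMap.mul ℝ A).flip y) := by
    refine Commute.neg_right (ContinuousLinearMap.ext fun w => ?_)
    simp [mul_assoc]
  have h2 := h0 (commutatorCLM y) v
  have hc : commutatorCLM y = ContinuousLinearMap.mul ℝ A y +
      -(ContinuousLinearMap.mul ℝ A).flip y := sub_eq_add_neg _ _
  have h3 : exp (commutatorCLM y) v = exp y * v * exp (-y) := by
    rw [hc, exp_add_of_commute hcomm, mul_apply_eq_comp, hl, hr, ← mul_assoc]
  rwa [h3] at h2

theorem conj_exp_sub_mem {S : Submodule ℝ A} (hS : IsClosed (S : Set A)) (y v : A)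
    (h : ∀ k, 2 ≤ k → (commutatorCLM y ^ k) v ∈ S) :
    exp y * v * exp (-y) - v - (y * v - v * y) ∈ S := by
  have h1 := (hasSum_nat_add_iff' 2).2 (hasSum_conj_exp y v)
  have h2 := hS.mem_of_tendsto h1 (Eventually.of_forall fun s =>
    S.sum_mem fun k _ => S.smul_mem _ (h (k + 2) (by omega)))
  simpa [Finset.sum_range_succ, commutatorCLM_apply, sub_sub] using h2

/-- If `x` can be removed from `h + x` step by step along a filtration, then `h + x` is conjugate
to `h`. -/
theorem exists_conj_eq_add [FiniteDimensional ℝ A] (Γ : Subgroup Aˣ) (F : ℕ → Submodule ℝ A) (h : A)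
    (hanti : Antitone F) {N : ℕ} (hN : F N = ⊥)
    (hexp : ∀ y ∈ F 1, ∃ g ∈ Γ, (g : A) = exp y)
    (hsolve : ∀ k, 1 ≤ k → ∀ x ∈ F k, ∃ y ∈ F k, x + (y * h - h * y) ∈ F (k + 1))
    (hlie : ∀ k, 1 ≤ k → ∀ y ∈ F k, ∀ x ∈ F k, y * x - x * y ∈ F (k + 1))
    {x : A} (hx : x ∈ F 1) : ∃ g ∈ Γ, (g : A) * h * ((g⁻¹ : Aˣ) : A) = h + x := by
  suffices H : ∀ j k, 1 ≤ k → N ≤ k + j → ∀ x ∈ F k,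
      ∃ g ∈ Γ, (g : A) * (h + x) * ((g⁻¹ : Aˣ) : A) = h by
    obtain ⟨g, hg, hgx⟩ := H N 1 le_rfl (by omega) x hx
    refine ⟨g⁻¹, inv_mem hg, ?_⟩
    nth_rewrite 1 [← hgx]
    simp [mul_assoc]
  intro j
  induction j with
  | zero =>
    intro k _ hk x hx
    have : x = 0 := by
      have := hanti hk hx
      rwa [hN, Submodule.mem_bot] at this
    exact ⟨1, one_mem _, by simp [this]⟩
  | succ j ih =>
    intro k hk1 hk x hx
    obtain ⟨y, hy, hyx⟩ := hsolve k hk1 x hx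
    obtain ⟨g₁, hg₁, hg₁y⟩ := hexp y (hanti hk1 hy)
    have hle : F (k + 1) ≤ F k := hanti (Nat.le_succ k)
    have hyh : y * h - h * y ∈ F k := by
      have := (F k).sub_mem (hle hyx) hx
      simpa using this
    have h2 : ∀ i, 2 ≤ i → (commutatorCLM y ^ i) (h + x) ∈ F (k + 1) := by
      intro i hi
      induction i, hi using Nat.le_induction with
      | base =>
        rw [pow_two, mul_apply_eq_comp, commutatorCLM_apply y (h + x)]
        refine hlie k hk1 y hy _ ?_
        have : y * (h + x) - (h + x) * y = (y * h - h * y) + (y * x - x * y) := by noncomm_ring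
        rw [this]
        exact (F k).add_mem hyh (hle (hlie k hk1 y hy x hx))
      | succ i _ ih =>
        rw [pow_succ', mul_apply_eq_comp]
        exact hlie k hk1 y hy _ (hle ih)
    have h3 := conj_exp_sub_mem (Submodule.closed_of_finiteDimensional (F (k + 1))) y (h + x) h2
    -- The choice of `y` handles `x + [y, h]`, the filtration handles `[y, x]`, and `h3` handles the
    -- terms of order at least two.
    have h4 : exp y * (h + x) * exp (-y) - h ∈ F (k + 1) := by
      have : exp y * (h + x) * exp (-y) - h =
          (exp y * (h + x) * exp (-y) - (h + x) - (y * (h + x) - (h + x) * y)) +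
            (x + (y * h - h * y)) + (y * x - x * y) := by noncomm_ring
      rw [this]
      exact Submodule.add_mem _ (Submodule.add_mem _ h3 hyx) (hlie k hk1 y hy x hx)
    obtain ⟨g₂, hg₂, hg₂x⟩ := ih (k + 1) (by omega) (by omega) _ h4
    refine ⟨g₂ * g₁, mul_mem hg₂ hg₁, ?_⟩
    rw [add_sub_cancel, ← hg₁y, ← Units.inv_eq_exp_neg hg₁y] at hg₂x
    nth_rewrite 2 [← hg₂x]
    simp [mul_assoc]

end ConjExp

/-! ### Connected closed groups are generated by exponentials. -/

section ClosedSubgroupTheorem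

open NormedSpace Topology Filter

variable {A : Type*} [NormedRing A] [NormedAlgebra ℝ A] [CompleteSpace A]
  [FiniteDimensional ℝ A] (H : ClosedSubgroup Aˣ)

/-- Small exponentials of vectors transverse to the generators are not in the group. -/
theorem ClosedSubgroup.eventually_exp_notMem (m : Submodule ℝ A)
    (hm : Disjoint H.generators m) :
    ∀ᶠ Y : m in 𝓝 0, (∃ g ∈ H, (g : A) = exp (Y : A)) → Y = 0 := by
  let _ : NormedAlgebra ℚ A := NormedAlgebra.restrictScalars ℚ ℝ A
  by_contra hcon
  have hfr : ∃ᶠ Y : m in 𝓝 0, (∃ g ∈ H, (g : A) = exp (Y : A)) ∧ Y ≠ 0 := by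
    rw [Filter.not_eventually] at hcon
    exact hcon.mono fun Y hY => by rwa [Classical.not_imp] at hY
  obtain ⟨Y, hY0, hY⟩ := exists_seq_forall_of_frequently hfr
  have hpos : ∀ k, 0 < ‖Y k‖ := fun k => norm_pos_iff.2 (hY k).2
  have hsph : ∀ k, ‖Y k‖⁻¹ • Y k ∈ Metric.sphere (0 : m) 1 := fun k => by
    rw [mem_sphere_zero_iff_norm, norm_smul, norm_inv, norm_norm, inv_mul_cancel₀ (hpos k).ne']
  obtain ⟨Z, hZ, φ, hφ, hlim⟩ := (isCompact_sphere (0 : m) 1).tendsto_subseq hsph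
  have hZgen : (Z : A) ∈ H.generators := by
    intro t
    have hn : Tendsto (fun k => ‖Y (φ k)‖) atTop (𝓝 0) := by
      have := (hY0.comp hφ.tendsto_atTop).norm
      simpa using this
    -- Rounding `t / ‖Y‖` to an integer makes `exp (t Z)` a limit of powers of the group elements
    -- `exp Y`, so the limit direction `Z` is a generator.
    have hfl : Tendsto (fun k => (⌊t / ‖Y (φ k)‖⌋ : ℝ) * ‖Y (φ k)‖) atTop (𝓝 t) := by
      have h1 : ∀ k, |(⌊t / ‖Y (φ k)‖⌋ : ℝ) * ‖Y (φ k)‖ - t| ≤ ‖Y (φ k)‖ := by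
        intro k
        have hp := hpos (φ k)
        have h2 : (⌊t / ‖Y (φ k)‖⌋ : ℝ) * ‖Y (φ k)‖ - t =
            ((⌊t / ‖Y (φ k)‖⌋ : ℝ) - t / ‖Y (φ k)‖) * ‖Y (φ k)‖ := by
          rw [sub_mul, div_mul_cancel₀ _ hp.ne']
        rw [h2, abs_mul, abs_of_pos hp]
        refine mul_le_of_le_one_left hp.le ?_
        rw [abs_le]
        constructor <;> linarith [Int.floor_le (t / ‖Y (φ k)‖), Int.lt_floor_add_one (t / ‖Y (φ k)‖)]
      rw [tendsto_iff_norm_sub_tendsto_zero]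
      exact squeeze_zero (fun _ => norm_nonneg _) h1 hn
    have h3 : Tendsto (fun k => (⌊t / ‖Y (φ k)‖⌋ : ℝ) • (Y (φ k) : A)) atTop (𝓝 (t • (Z : A))) := by
      have h4 := hfl.smul ((continuous_subtype_val.tendsto Z).comp hlim)
      refine h4.congr fun k => ?_
      simp only [Function.comp_apply, Submodule.coe_smul, smul_smul]
      rw [mul_assoc, mul_inv_cancel₀ (hpos _).ne', mul_one]
    obtain ⟨u, hu⟩ := exists_unit_eq_exp (t • (Z : A))
    refine ⟨u, ?_, hu⟩
    choose g hg hgY using fun k => (hY k).1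
    have h5 : Tendsto (fun k => g (φ k) ^ ⌊t / ‖Y (φ k)‖⌋) atTop (𝓝 u) := by
      rw [Units.isOpenEmbedding_val.isInducing.tendsto_nhds_iff, hu]
      refine ((exp_continuous (𝔸 := A)).tendsto _).comp h3 |>.congr fun k => ?_
      simp only [Function.comp_apply]
      have h6 : ∀ z : ℤ, exp ((z : ℝ) • (Y (φ k) : A)) = ((g (φ k) ^ z : Aˣ) : A) := by
        have h7 : ∀ j : ℕ, exp ((j : ℝ) • (Y (φ k) : A)) = ((g (φ k) ^ j : Aˣ) : A) := fun j => by
          rw [Nat.cast_smul_eq_nsmul, exp_nsmul, Units.val_pow_eq_pow_val, hgY]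
        intro z
        obtain ⟨j, rfl | rfl⟩ := z.eq_nat_or_neg
        · simpa using h7 j
        · rw [zpow_neg, zpow_natCast, Units.inv_eq_exp_neg (h7 j).symm, ← neg_smul]
          push_cast
          rfl
      exact h6 _
    exact H.isClosed'.mem_of_tendsto h5 (Eventually.of_forall fun k => zpow_mem (hg _) _)
  have h0 : (Z : A) = 0 := (Submodule.disjoint_def.1 hm) _ hZgen Z.2
  have : Z = 0 := Subtype.ext h0
  rw [this, mem_sphere_zero_iff_norm, norm_zero] at hZ
  exact zero_ne_one hZ

/-- A connected closed group is generated by exponentials. -/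
theorem ClosedSubgroup.le_closure_exp (hconn : IsConnected (H : Set Aˣ)) :
    H.toSubgroup ≤ Subgroup.closure {g : Aˣ | ∃ X ∈ H.generators, (g : A) = exp X} := by
  let _ : NormedAlgebra ℚ A := NormedAlgebra.restrictScalars ℚ ℝ A
  set K := Subgroup.closure {g : Aˣ | ∃ X ∈ H.generators, (g : A) = exp X} with hK
  obtain ⟨m, hm⟩ := H.generators.exists_isCompl
  have hd : HasStrictFDerivAt (fun p : H.generators × m => exp (p.1 : A) * exp (p.2 : A))
      (H.generators.subtypeL.coprod m.subtypeL) 0 := by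
    have h1 : HasStrictFDerivAt (exp : A → A) (1 : A →L[ℝ] A) 0 := hasStrictFDerivAt_exp_zero
    have h2 : HasStrictFDerivAt (fun p : H.generators × m => exp (p.1 : A))
        (H.generators.subtypeL ∘L ContinuousLinearMap.fst ℝ H.generators m) 0 :=
      HasStrictFDerivAt.comp (g := exp) (g' := (1 : A →L[ℝ] A)) (0 : H.generators × m) (by simpa)
        (H.generators.subtypeL ∘L ContinuousLinearMap.fst ℝ H.generators m).hasStrictFDerivAt
    have h3 : HasStrictFDerivAt (fun p : H.generators × m => exp (p.2 : A))
        (m.subtypeL ∘L ContinuousLinearMap.snd ℝ H.generators m) 0 :=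
      HasStrictFDerivAt.comp (g := exp) (g' := (1 : A →L[ℝ] A)) (0 : H.generators × m) (by simpa)
        (m.subtypeL ∘L ContinuousLinearMap.snd ℝ H.generators m).hasStrictFDerivAt
    refine (h2.mul' h3).congr_fderiv (ContinuousLinearMap.ext fun p => ?_)
    simp [add_comm]
  have hsurj : (H.generators.subtypeL.coprod m.subtypeL).range = ⊤ := by
    rw [LinearMap.range_eq_top]
    intro a
    obtain ⟨x, hx, y, hy, hxy⟩ := Submodule.mem_sup.1
      (hm.sup_eq_top ▸ Submodule.mem_top : a ∈ H.generators ⊔ m)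
    exact ⟨(⟨x, hx⟩, ⟨y, hy⟩), by simpa using hxy⟩
  have hmap := hd.map_nhds_eq_of_surj hsurj
  simp only [Prod.fst_zero, Prod.snd_zero, ZeroMemClass.coe_zero, exp_zero, mul_one] at hmap
  have hev := H.eventually_exp_notMem m hm.disjoint
  -- Near 1 every element is `exp X * exp Y` with `X` a generator and `Y` small and transverse; for
  -- an element of the group, `Y = 0`.
  have hnear : ∀ᶠ a : A in 𝓝 1, ∀ g ∈ H, (g : A) = a → g ∈ K := by
    rw [← hmap, eventually_map]
    have hev' : ∀ᶠ p : H.generators × m in 𝓝 0,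
        (∃ g ∈ H, (g : A) = exp (p.2 : A)) → p.2 = 0 :=
      (continuous_snd.tendsto (0 : H.generators × m)).eventually hev
    filter_upwards [hev'] with p hp g hg hgp
    obtain ⟨k, hk, hk'⟩ := p.1.2 1
    rw [one_smul] at hk'
    have h1 : ((k⁻¹ * g : Aˣ) : A) = exp (p.2 : A) := by
      rw [Units.val_mul, hgp, ← hk', ← mul_assoc, Units.inv_mul, one_mul]
    have h2 := hp ⟨k⁻¹ * g, mul_mem (inv_mem hk) hg, h1⟩
    refine Subgroup.subset_closure ⟨p.1, p.1.2, ?_⟩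
    rw [hgp, h2]
    simp
  have hopen : IsOpen ((K.subgroupOf H.toSubgroup : Subgroup H.toSubgroup) : Set H.toSubgroup) := by
    refine Subgroup.isOpen_of_mem_nhds _ (g := 1) ?_
    have hc : Tendsto (fun g : H.toSubgroup => ((g : Aˣ) : A)) (𝓝 1) (𝓝 1) :=
      (Units.continuous_val.comp continuous_subtype_val).tendsto (1 : H.toSubgroup)
    filter_upwards [hc.eventually hnear] with g hg
    exact hg g g.2 rfl
  have : ConnectedSpace H.toSubgroup := isConnected_iff_connectedSpace.1 hconn
  have huniv := IsClopen.eq_univ ⟨Subgroup.isClosed_of_isOpen _ hopen, hopen⟩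
    ⟨1, one_mem (K.subgroupOf H.toSubgroup)⟩
  intro g hg
  have : (⟨g, hg⟩ : H.toSubgroup) ∈
      ((K.subgroupOf H.toSubgroup : Subgroup H.toSubgroup) : Set H.toSubgroup) := by
    rw [huniv]; trivial
  exact this

end ClosedSubgroupTheorem

/-! ## Images of polynomial maps and orbits of polynomial flows -/

section PolynomialFlows

open MvPolynomial

/-- The image of a polynomial map contains a nonempty open subset of its Zariski closure. -/
theorem MvPolynomial.exists_ne_zero_forall_mem_range {K σ ι : Type*} [Field K] [IsAlgClosed K]
    [Finite σ] [Finite ι] (Φ : ι → MvPolynomial σ K) :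
    ∃ q : MvPolynomial ι K, aeval Φ q ≠ 0 ∧
      ∀ c : ι → K, (∀ p : MvPolynomial ι K, aeval Φ p = 0 → eval c p = 0) → eval c q ≠ 0 →
        ∃ t : σ → K, (fun i => eval t (Φ i)) = c := by
  set f : MvPolynomial ι K →+* MvPolynomial σ K := (aeval Φ).toRingHom with hf
  have hfp : f.FinitePresentation := by
    refine RingHom.FinitePresentation.of_finiteType.1 ?_
    refine RingHom.FiniteType.of_comp_finiteType (f := algebraMap K (MvPolynomial ι K)) ?_
    have : f.comp (algebraMap K (MvPolynomial ι K)) = algebraMap K (MvPolynomial σ K) :=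
      (aeval Φ).comp_algebraMap
    rw [this, RingHom.finiteType_algebraMap]
    infer_instance
  obtain ⟨S, hS⟩ := PrimeSpectrum.exists_constructibleSetData_iff.2
    (PrimeSpectrum.isConstructible_range_comap hfp)
  -- By Chevalley the image is constructible. The piece containing the image of the generic point
  -- has all its equations in the kernel of `f`, while `C.f` is not in it.
  have h0 : PrimeSpectrum.comap f ⊥ ∈ S.toSet := hS ▸ ⟨⊥, rfl⟩
  simp only [PrimeSpectrum.ConstructibleSetData.toSet, Set.mem_iUnion] at h0
  obtain ⟨C, hCS, hg, hq⟩ := h0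
  refine ⟨C.f, fun h => hq ?_, fun c hc hcq => ?_⟩
  · simpa [PrimeSpectrum.mem_zeroLocus, hf] using h
  let 𝔪 : PrimeSpectrum (MvPolynomial ι K) := ⟨vanishingIdeal K {c}, inferInstance⟩
  have hm : 𝔪 ∈ Set.range (PrimeSpectrum.comap f) := by
    rw [← hS]
    simp only [PrimeSpectrum.ConstructibleSetData.toSet, Set.mem_iUnion]
    refine ⟨C, hCS, fun p hp => ?_, fun h => hcq ?_⟩
    · have h1 := hg hp
      refine (mem_vanishingIdeal_singleton_iff c p).2 ?_
      rw [aeval_eq_eval]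
      refine hc p ?_
      simpa [hf] using h1
    · have h1 : C.f ∈ 𝔪.asIdeal := h (Set.mem_singleton _)
      have h2 := (mem_vanishingIdeal_singleton_iff c _).1 h1
      rwa [aeval_eq_eval] at h2
  obtain ⟨P, hP⟩ := hm
  obtain ⟨M, hM, hPM⟩ := Ideal.exists_le_maximal P.asIdeal P.2.ne_top
  obtain ⟨t, rfl⟩ := isMaximal_iff_eq_vanishingIdeal_singleton.1 hM
  refine ⟨t, _root_.funext fun i => ?_⟩
  have h1 : (X i - MvPolynomial.C (c i) : MvPolynomial ι K) ∈ 𝔪.asIdeal :=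
    (mem_vanishingIdeal_singleton_iff c _).2 (by simp)
  rw [← hP] at h1
  have h2 := (mem_vanishingIdeal_singleton_iff t _).1 (hPM h1)
  simpa [hf, sub_eq_zero, aeval_eq_eval] using h2

variable {K ι : Type*} [Field K]

/-- The value of the polynomial flow `A` at time `t` and position `x`. -/
noncomputable def evalFlow (A : ι → MvPolynomial (Option ι) K) (t : K) (x : ι → K) : ι → K :=
  fun i => eval (fun o => o.elim t x) (A i)

/-- The points which can be reached from `z` along the flows in `𝓕`. -/
inductive FlowReachable (𝓕 : Set (ι → MvPolynomial (Option ι) K)) (z : ι → K) : (ι → K) → Prop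
  | refl : FlowReachable 𝓕 z z
  | flow {A : ι → MvPolynomial (Option ι) K} (hA : A ∈ 𝓕) (t : K) {x : ι → K}
      (hx : FlowReachable 𝓕 z x) : FlowReachable 𝓕 z (evalFlow A t x)

theorem aeval_eq_zero_iff_forall_eval [Infinite K] {σ : Type*} (Φ : ι → MvPolynomial σ K)
    (p : MvPolynomial ι K) :
    aeval Φ p = 0 ↔ ∀ t : σ → K, eval (fun i => eval t (Φ i)) p = 0 := by
  have h : ∀ t : σ → K, eval t (aeval Φ p) = eval (fun i => eval t (Φ i)) p := by
    intro t
    rw [← aeval_eq_eval t, ← aeval_eq_eval]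
    change ((aeval t).comp (aeval Φ)) p = _
    rw [comp_aeval]
  simp_rw [← h]
  exact ⟨fun h0 t => by rw [h0, map_zero], fun h0 => MvPolynomial.funext fun t => by rw [h0, map_zero]⟩

/-- A set which is swept out by polynomial flows is open in its closure, in a weak sense. -/
theorem exists_eval_ne_zero_forall_flowReachable [IsAlgClosed K] [TopologicalSpace K]
    [IsTopologicalRing K] [T1Space K] [Finite ι] (𝓕 : Set (ι → MvPolynomial (Option ι) K))
    (h𝓕 : ∀ A ∈ 𝓕, ∀ x, evalFlow A 0 x = x) (z : ι → K) :
    ∃ q : MvPolynomial ι K, (∃ s, FlowReachable 𝓕 z s ∧ eval s q ≠ 0) ∧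
      ∀ c ∈ closure {s | FlowReachable 𝓕 z s}, eval c q ≠ 0 → FlowReachable 𝓕 z c := by
  have : Infinite K := IsAlgClosed.instInfinite
  let param (σ : Type) (Φ : ι → MvPolynomial σ K) : Prop :=
    Finite σ ∧ (∀ t : σ → K, FlowReachable 𝓕 z fun i => eval t (Φ i)) ∧
      ∃ t : σ → K, (fun i => eval t (Φ i)) = z
  let vanishing (σ : Type) (Φ : ι → MvPolynomial σ K) : Ideal (MvPolynomial ι K) :=
    RingHom.ker (aeval Φ)
  let hts : Set ℕ∞ := {m | ∃ (σ : Type) (Φ : ι → MvPolynomial σ K), param σ Φ ∧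
    (vanishing σ Φ).height = m}
  have hne : hts.Nonempty := by
    refine ⟨_, Empty, fun i => C (z i), ⟨inferInstance, fun t => ?_, Empty.elim, ?_⟩, rfl⟩
    · simpa using FlowReachable.refl
    · simp
  -- Minimal height of the vanishing ideal means an image closure of largest dimension.
  obtain ⟨σ, Φ, ⟨hσ, hreach, t₀, ht₀⟩, hmin⟩ := wellFounded_lt.min_mem hts hne
  have hker : ∀ p, aeval Φ p = 0 → ∀ A ∈ 𝓕, ∀ (t : K) (s : σ → K),
      eval (evalFlow A t fun i => eval s (Φ i)) p = 0 := by
    intro p hp A hA t s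
    let Ψ : ι → MvPolynomial (Option σ) K := fun i =>
      aeval (fun o : Option ι => o.elim (X none) fun j => rename some (Φ j)) (A i)
    have hΨ : ∀ s : Option σ → K, (fun i => eval s (Ψ i)) =
        evalFlow A (s none) fun i => eval (fun j => s (some j)) (Φ i) := by
      intro s
      funext i
      simp only [Ψ, evalFlow]
      rw [← aeval_eq_eval s, ← aeval_eq_eval]
      change ((aeval s).comp (aeval _)) (A i) = _
      rw [comp_aeval]
      congr 2
      funext o
      cases o with
      | none => simp
      | some j => simp [aeval_eq_eval, eval_rename, Function.comp_def]
    have hparam : param (Option σ) Ψ := by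
      refine ⟨inferInstance, fun t => ?_, fun o => o.elim 0 t₀, ?_⟩
      · rw [hΨ]
        exact .flow hA _ (hreach _)
      · rw [hΨ]
        simpa [ht₀] using h𝓕 A hA z
    -- At time 0 the extended parametrization `Ψ` restricts to `Φ`. Minimality of the height makes
    -- the two prime ideals equal, so the image closure is stable under every flow.
    have hle : vanishing _ Ψ ≤ vanishing σ Φ := by
      intro p hp
      simp only [vanishing] at hp ⊢
      rw [RingHom.mem_ker, aeval_eq_zero_iff_forall_eval] at hp ⊢
      intro t
      have := hp fun o => o.elim 0 t
      rw [hΨ] at this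
      simpa [h𝓕 A hA] using this
    have hht : (vanishing σ Φ).height ≤ (vanishing _ Ψ).height := by
      rw [hmin]
      exact not_lt.1 (wellFounded_lt.not_lt_min hts ⟨_, Ψ, hparam, rfl⟩)
    have : (vanishing _ Ψ).IsPrime := RingHom.ker_isPrime _
    have heq := Ideal.eq_of_le_of_height_le _ hle hht
    have hp' : aeval Ψ p = 0 := by
      have : p ∈ vanishing _ Ψ := heq ▸ hp
      exact this
    have := (aeval_eq_zero_iff_forall_eval Ψ p).1 hp' fun o => o.elim t s
    rwa [hΨ] at this
  have hzero : ∀ s, FlowReachable 𝓕 z s → ∀ p, aeval Φ p = 0 → eval s p = 0 := by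
    intro s hs
    induction hs with
    | refl =>
      intro p hp
      rw [← ht₀]
      exact (aeval_eq_zero_iff_forall_eval Φ p).1 hp t₀
    | @flow A hA t x hx ih =>
      intro p hp
      let B : ι → MvPolynomial ι K := fun i => aeval (fun o : Option ι => o.elim (C t) X) (A i)
      have hB : ∀ y : ι → K, (fun i => eval y (B i)) = evalFlow A t y := by
        intro y
        funext i
        simp only [B, evalFlow]
        rw [← aeval_eq_eval y, ← aeval_eq_eval]
        change ((aeval y).comp (aeval _)) (A i) = _
        rw [comp_aeval]
        congr 2
        funext o
        cases o <;> simp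
      have hBp : ∀ y : ι → K, eval y (aeval B p) = eval (evalFlow A t y) p := by
        intro y
        rw [← aeval_eq_eval y, ← aeval_eq_eval, ← hB]
        change ((aeval y).comp (aeval _)) p = _
        rw [comp_aeval]
        simp [aeval_eq_eval]
      rw [← hBp]
      refine ih _ ?_
      rw [aeval_eq_zero_iff_forall_eval]
      intro s
      rw [hBp]
      exact hker p hp A hA t s
  obtain ⟨q, hq, hqr⟩ := MvPolynomial.exists_ne_zero_forall_mem_range Φ
  refine ⟨q, ?_, fun c hc hcq => ?_⟩
  · rw [Ne, aeval_eq_zero_iff_forall_eval, not_forall] at hq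
    obtain ⟨t, ht⟩ := hq
    exact ⟨_, hreach t, ht⟩
  · have hcp : ∀ p, aeval Φ p = 0 → eval c p = 0 := fun p hp =>
      closure_minimal (fun s hs => hzero s hs p hp)
        (isClosed_singleton.preimage (MvPolynomial.continuous_eval p)) hc
    obtain ⟨t, rfl⟩ := hqr c hcp hcq
    exact hreach t

end PolynomialFlows

/-! ## Orbits under unipotent one-parameter groups -/

noncomputable section UnipotentOrbits

open NormedSpace Matrix Topology

variable {n : ℕ}

theorem GeneralLinearGroup.inv_eq_exp_neg {g : GL (Fin n) ℂ} {y : Matrix (Fin n) (Fin n) ℂ}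
    (hg : (g : Matrix (Fin n) (Fin n) ℂ) = exp y) :
    ((g⁻¹ : GL (Fin n) ℂ) : Matrix (Fin n) (Fin n) ℂ) = exp (-y) := by
  let _ : NormedRing (Matrix (Fin n) (Fin n) ℂ) := Matrix.linftyOpNormedRing
  let _ : NormedAlgebra ℝ (Matrix (Fin n) (Fin n) ℂ) := Matrix.linftyOpNormedAlgebra
  exact Units.inv_eq_exp_neg hg

theorem GeneralLinearGroup.exists_eq_exp (y : Matrix (Fin n) (Fin n) ℂ) :
    ∃ g : GL (Fin n) ℂ, (g : Matrix (Fin n) (Fin n) ℂ) = exp y := by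
  let _ : NormedRing (Matrix (Fin n) (Fin n) ℂ) := Matrix.linftyOpNormedRing
  let _ : NormedAlgebra ℝ (Matrix (Fin n) (Fin n) ℂ) := Matrix.linftyOpNormedAlgebra
  exact exists_unit_eq_exp y

/-- The entries of a matrix, as a function on the pairs of indices. -/
def Matrix.entries (y : Matrix (Fin n) (Fin n) ℂ) (p : Fin n × Fin n) : ℂ := y p.1 p.2

theorem Matrix.entries_of_curry (s : Fin n × Fin n → ℂ) :
    (Matrix.of (Function.curry s)).entries = s := rfl

theorem exp_smul_eq_sum_of_pow_eq_zero {x : Matrix (Fin n) (Fin n) ℂ} {N : ℕ} (hN : x ^ N = 0)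
    (t : ℂ) : exp (t • x) = ∑ k ∈ Finset.range N, ((k.factorial : ℂ)⁻¹ * t ^ k) • x ^ k := by
  have : exp (t • x) = ∑' k : ℕ, ((k.factorial : ℂ)⁻¹) • (t • x) ^ k := by
    rw [exp_eq_tsum ℂ]
  rw [this, tsum_eq_sum (s := Finset.range N)]
  · exact Finset.sum_congr rfl fun k _ => by rw [smul_pow, smul_smul]
  · intro k hk
    rw [Finset.mem_range, not_lt] at hk
    rw [smul_pow, pow_eq_zero_of_le hk hN, smul_zero, smul_zero]

/-- Conjugation by the exponentials of the multiples of a nilpotent matrix is a polynomial flow. -/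
theorem exists_evalFlow_eq_conj {x : Matrix (Fin n) (Fin n) ℂ} (hx : IsNilpotent x) :
    ∃ A : Fin n × Fin n → MvPolynomial (Option (Fin n × Fin n)) ℂ,
      ∀ (t : ℂ) (y : Matrix (Fin n) (Fin n) ℂ), evalFlow A t (Matrix.entries y) =
        Matrix.entries (exp (t • x) * y * exp ((-t) • x) : Matrix (Fin n) (Fin n) ℂ) := by
  obtain ⟨N, hN⟩ := hx
  let R := MvPolynomial (Option (Fin n × Fin n)) ℂ
  let E : R → Matrix (Fin n) (Fin n) R := fun T =>
    ∑ k ∈ Finset.range N, (MvPolynomial.C ((k.factorial : ℂ)⁻¹) * T ^ k) •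
      (x ^ k).map (MvPolynomial.C : ℂ →+* R)
  let Y : Matrix (Fin n) (Fin n) R := Matrix.of fun i j => MvPolynomial.X (some (i, j))
  have hE : ∀ (v : Option (Fin n × Fin n) → ℂ) (T : R),
      (E T).map (MvPolynomial.eval v) = exp (MvPolynomial.eval v T • x) := by
    intro v T
    rw [exp_smul_eq_sum_of_pow_eq_zero hN]
    ext i j
    simp [E, Matrix.sum_apply]
  refine ⟨fun p => (E (MvPolynomial.X none) * Y * E (-MvPolynomial.X none)) p.1 p.2,
    fun t y => funext fun p => ?_⟩
  set v : Option (Fin n × Fin n) → ℂ := fun o => o.elim t (Matrix.entries y) with hv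
  have h1 : ((E (MvPolynomial.X none) * Y * E (-MvPolynomial.X none)).map
      (MvPolynomial.eval v)) = exp (t • x) * y * exp ((-t) • x) := by
    have hY : Y.map (MvPolynomial.eval v) = y := by
      ext i j
      simp [Y, hv, Matrix.entries]
    rw [Matrix.map_mul, Matrix.map_mul, hE, hE, hY]
    simp [hv]
  exact congrFun (congrFun h1 p.1) p.2

/-- The group generated by the complex one-parameter groups of the nilpotent matrices in `S`. -/
def unipotentGroup (S : Set (Matrix (Fin n) (Fin n) ℂ)) : Subgroup (GL (Fin n) ℂ) :=
  Subgroup.closure {g | ∃ x ∈ S, IsNilpotent x ∧ ∃ t : ℂ,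
    (g : Matrix (Fin n) (Fin n) ℂ) = exp (t • x)}

theorem mem_adjointOrbit_self (H : Subgroup (GL (Fin n) ℂ)) (X : Matrix (Fin n) (Fin n) ℂ) :
    X ∈ adjointOrbit H X := ⟨1, one_mem H, by simp⟩

theorem conj_mem_adjointOrbit {H : Subgroup (GL (Fin n) ℂ)} {X Y : Matrix (Fin n) (Fin n) ℂ}
    {g : GL (Fin n) ℂ} (hg : g ∈ H) (hY : Y ∈ adjointOrbit H X) :
    (g : Matrix (Fin n) (Fin n) ℂ) * Y * ((g⁻¹ : GL (Fin n) ℂ) : Matrix (Fin n) (Fin n) ℂ) ∈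
      adjointOrbit H X := by
  obtain ⟨k, hk, rfl⟩ := hY
  exact ⟨g * k, mul_mem hg hk, by simp [mul_assoc]⟩

theorem adjointOrbit_mono {H K : Subgroup (GL (Fin n) ℂ)} (h : H ≤ K)
    (X : Matrix (Fin n) (Fin n) ℂ) : adjointOrbit H X ⊆ adjointOrbit K X := by
  rintro _ ⟨g, hg, rfl⟩
  exact ⟨g, h hg, rfl⟩

theorem mem_adjointOrbit_comm {H : Subgroup (GL (Fin n) ℂ)} {X Y : Matrix (Fin n) (Fin n) ℂ}
    (h : Y ∈ adjointOrbit H X) : X ∈ adjointOrbit H Y := by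
  obtain ⟨g, hg, rfl⟩ := h
  exact ⟨g⁻¹, inv_mem hg, by simp [mul_assoc]⟩

theorem adjointOrbit_eq_of_mem {H : Subgroup (GL (Fin n) ℂ)} {X Y : Matrix (Fin n) (Fin n) ℂ}
    (h : Y ∈ adjointOrbit H X) : adjointOrbit H Y = adjointOrbit H X := by
  refine Set.Subset.antisymm ?_ ?_
  · rintro _ ⟨g, hg, rfl⟩
    exact conj_mem_adjointOrbit hg h
  · rintro _ ⟨g, hg, rfl⟩
    exact conj_mem_adjointOrbit hg (mem_adjointOrbit_comm h)

/-- The orbits of a group generated by unipotent one-parameter groups are open in their closures,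
in a weak sense. -/
theorem exists_eval_ne_zero_forall_mem_adjointOrbit (S : Set (Matrix (Fin n) (Fin n) ℂ))
    (z : Matrix (Fin n) (Fin n) ℂ) :
    ∃ q : MvPolynomial (Fin n × Fin n) ℂ,
      (∃ s ∈ adjointOrbit (unipotentGroup S) z, MvPolynomial.eval (Matrix.entries s) q ≠ 0) ∧
      ∀ c ∈ closure (adjointOrbit (unipotentGroup S) z),
        MvPolynomial.eval (Matrix.entries c) q ≠ 0 → c ∈ adjointOrbit (unipotentGroup S) z := by
  let 𝓕 : Set (Fin n × Fin n → MvPolynomial (Option (Fin n × Fin n)) ℂ) :=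
    {A | ∃ x ∈ S, IsNilpotent x ∧ ∀ (t : ℂ) (y : Matrix (Fin n) (Fin n) ℂ),
      evalFlow A t (Matrix.entries y) =
        Matrix.entries (exp (t • x) * y * exp ((-t) • x) : Matrix (Fin n) (Fin n) ℂ)}
  have hgen : ∀ g ∈ {g : GL (Fin n) ℂ | ∃ x ∈ S, IsNilpotent x ∧ ∃ t : ℂ,
      (g : Matrix (Fin n) (Fin n) ℂ) = exp (t • x)}, ∀ y : Matrix (Fin n) (Fin n) ℂ,
      FlowReachable 𝓕 (Matrix.entries z) (Matrix.entries y) →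
      FlowReachable 𝓕 (Matrix.entries z) (Matrix.entries ((g : Matrix (Fin n) (Fin n) ℂ) * y *
        ((g⁻¹ : GL (Fin n) ℂ) : Matrix (Fin n) (Fin n) ℂ))) := by
    rintro g ⟨x, hx, hxn, t, hg⟩ y hy
    obtain ⟨A, hA⟩ := exists_evalFlow_eq_conj hxn
    have := FlowReachable.flow (𝓕 := 𝓕) ⟨x, hx, hxn, hA⟩ t hy
    rwa [hA, ← hg, neg_smul, ← GeneralLinearGroup.inv_eq_exp_neg hg] at this
  have hinv : ∀ g ∈ {g : GL (Fin n) ℂ | ∃ x ∈ S, IsNilpotent x ∧ ∃ t : ℂ,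
      (g : Matrix (Fin n) (Fin n) ℂ) = exp (t • x)}, g⁻¹ ∈ {g : GL (Fin n) ℂ | ∃ x ∈ S,
        IsNilpotent x ∧ ∃ t : ℂ, (g : Matrix (Fin n) (Fin n) ℂ) = exp (t • x)} := by
    rintro g ⟨x, hx, hxn, t, hg⟩
    exact ⟨x, hx, hxn, -t, by rw [neg_smul, GeneralLinearGroup.inv_eq_exp_neg hg]⟩
  have hreach : ∀ g ∈ unipotentGroup S, ∀ y : Matrix (Fin n) (Fin n) ℂ,
      FlowReachable 𝓕 (Matrix.entries z) (Matrix.entries y) →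
      FlowReachable 𝓕 (Matrix.entries z) (Matrix.entries ((g : Matrix (Fin n) (Fin n) ℂ) * y *
        ((g⁻¹ : GL (Fin n) ℂ) : Matrix (Fin n) (Fin n) ℂ))) := by
    intro g hg
    induction hg using Subgroup.closure_induction_left with
    | one => intro y hy; simpa using hy
    | mul_left g hg k _ ih =>
      intro y hy
      have := hgen g hg _ (ih y hy)
      simpa [mul_assoc] using this
    | inv_mul_cancel g hg k _ ih =>
      intro y hy
      have := hgen _ (hinv g hg) _ (ih y hy)
      simpa [mul_assoc] using this
  have horbit : ∀ s : Fin n × Fin n → ℂ, FlowReachable 𝓕 (Matrix.entries z) s →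
      Matrix.of (Function.curry s) ∈ adjointOrbit (unipotentGroup S) z := by
    intro s hs
    induction hs with
    | refl => exact mem_adjointOrbit_self _ z
    | @flow A hA t s _ ih =>
      obtain ⟨x, hx, hxn, hA⟩ := hA
      obtain ⟨g, hg⟩ := GeneralLinearGroup.exists_eq_exp (t • x)
      have hgS : g ∈ unipotentGroup S := Subgroup.subset_closure ⟨x, hx, hxn, t, hg⟩
      have h1 := conj_mem_adjointOrbit hgS ih
      have h2 := hA t (Matrix.of (Function.curry s))
      rw [neg_smul, ← GeneralLinearGroup.inv_eq_exp_neg hg, ← hg] at h2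
      have h3 : Matrix.entries (Matrix.of (Function.curry s)) = s := Matrix.entries_of_curry s
      rw [h3] at h2
      rw [h2]
      exact h1
  obtain ⟨q, ⟨s, hs, hsq⟩, hq⟩ := exists_eval_ne_zero_forall_flowReachable 𝓕
    (by
      rintro A ⟨x, -, -, hA⟩ s
      have h2 := hA 0 (Matrix.of (Function.curry s))
      have h3 : Matrix.entries (Matrix.of (Function.curry s)) = s := Matrix.entries_of_curry s
      rw [h3] at h2
      rw [h2]
      simpa using h3) (Matrix.entries z)
  refine ⟨q, ⟨_, horbit s hs, hsq⟩, fun c hc hcq => ?_⟩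
  refine horbit c.entries (hq _ ?_ hcq)
  have hcont : Continuous fun y : Matrix (Fin n) (Fin n) ℂ =>
      (Matrix.entries y : Fin n × Fin n → ℂ) :=
    continuous_pi fun p => (continuous_apply p.2).comp (continuous_apply p.1)
  refine closure_mono ?_ (image_closure_subset_closure_image hcont ⟨c, hc, rfl⟩)
  rintro _ ⟨_, ⟨g, hg, rfl⟩, rfl⟩
  exact hreach g hg z .refl

end UnipotentOrbits

/-! ## The neutral element and its nilradical -/

noncomputable section RealNilradical

open NormedSpace Matrix Topology Filter

variable {n : ℕ} {GR : ClosedSubgroup (GL (Fin n) ℂ)}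

theorem conj_mem_lieAlgebraOf {g : GL (Fin n) ℂ} (hg : g ∈ GR) {X : Matrix (Fin n) (Fin n) ℂ}
    (hX : X ∈ lieAlgebraOf GR) : (g : Matrix (Fin n) (Fin n) ℂ) * X *
      ((g⁻¹ : GL (Fin n) ℂ) : Matrix (Fin n) (Fin n) ℂ) ∈ lieAlgebraOf GR := by
  intro t
  obtain ⟨k, hk, hk'⟩ := hX t
  refine ⟨g * k * g⁻¹, mul_mem (mul_mem hg hk) (inv_mem hg), ?_⟩
  rw [Units.val_mul, Units.val_mul, hk', ← Matrix.exp_units_conj]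
  congr 1
  simp

/-- Conjugation by an element of the group, as an automorphism of the Lie algebra. -/
def conjLieEquiv (g : GL (Fin n) ℂ) (hg : g ∈ GR) : lieAlgebraOf GR ≃ₗ⁅ℝ⁆ lieAlgebraOf GR where
  toFun X := ⟨_, conj_mem_lieAlgebraOf hg X.2⟩
  invFun X := ⟨_, conj_mem_lieAlgebraOf (inv_mem hg) X.2⟩
  map_add' X Y := Subtype.ext (by simp [mul_add, add_mul])
  map_smul' c X := Subtype.ext (by simp)
  map_lie' := by
    intro X Y
    refine Subtype.ext ?_
    simp [LieRing.of_associative_ring_bracket, mul_sub, sub_mul, mul_assoc]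
  left_inv X := Subtype.ext (by simp [mul_assoc])
  right_inv X := Subtype.ext (by simp [mul_assoc])

theorem continuous_conj (g : GL (Fin n) ℂ) :
    Continuous fun X : Matrix (Fin n) (Fin n) ℂ => (g : Matrix (Fin n) (Fin n) ℂ) * X *
      ((g⁻¹ : GL (Fin n) ℂ) : Matrix (Fin n) (Fin n) ℂ) := by fun_prop

/-- Connectedness of the real group enters here. -/
theorem le_complexification (hconn : IsConnected (GR : Set (GL (Fin n) ℂ))) :
    GR.toSubgroup ≤ complexification GR := by
  let _ : NormedRing (Matrix (Fin n) (Fin n) ℂ) := Matrix.linftyOpNormedRing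
  let _ : NormedAlgebra ℝ (Matrix (Fin n) (Fin n) ℂ) := Matrix.linftyOpNormedAlgebra
  refine (ClosedSubgroup.le_closure_exp GR hconn).trans (Subgroup.closure_mono ?_)
  rintro g ⟨X, hX, hg⟩
  have hX' : X ∈ lieAlgebraOf GR := hX
  exact ⟨X, Submodule.subset_span hX', hg⟩

variable {ι : Type*} {b : Module.Basis ι ℝ (lieAlgebraOf GR)} {d : ι → ℤ} {h : lieAlgebraOf GR}

theorem mem_realNilradical_iff (hb : ∀ k, ⁅h, b k⁆ = (d k : ℝ) • b k)
    {X : Matrix (Fin n) (Fin n) ℂ} :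
    X ∈ realNilradical GR h ↔ ∃ x ∈ b.geWeight d 1, (x : Matrix (Fin n) (Fin n) ℂ) = X := by
  constructor
  · suffices realNilradical GR h ≤
        (b.geWeight d 1).map ((lieAlgebraOf GR).incl : lieAlgebraOf GR →ₗ[ℝ] _) from
      fun hX => this hX
    refine iSup₂_le fun μ hμ X hX => ?_
    obtain ⟨hXL, hXe⟩ := hX
    refine ⟨⟨X, hXL⟩, fun k hk => ?_, rfl⟩
    by_contra hne
    have hlie : ⁅h, (⟨X, hXL⟩ : lieAlgebraOf GR)⁆ = μ • (⟨X, hXL⟩ : lieAlgebraOf GR) :=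
      Subtype.ext (Module.End.mem_eigenspace_iff.1 hXe)
    have h1 := weight_eq_of_repr_ne_zero hb hlie hne
    have h2 : (0 : ℝ) < d k := h1 ▸ hμ
    have h3 : 0 < d k := by exact_mod_cast h2
    omega
  · rintro ⟨x, hx, rfl⟩
    suffices b.geWeight d 1 ≤ (realNilradical GR h).comap
        ((lieAlgebraOf GR).incl : lieAlgebraOf GR →ₗ[ℝ] _) from this hx
    refine Module.Basis.geWeight_induction fun k hk => ?_
    have hpos : (0 : ℝ) < d k := by exact_mod_cast (by omega : 0 < d k)
    refine Submodule.mem_iSup_of_mem (d k : ℝ) (Submodule.mem_iSup_of_mem hpos ⟨(b k).2, ?_⟩)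
    rw [SetLike.mem_coe, Module.End.mem_eigenspace_iff]
    exact congrArg Subtype.val (hb k)

theorem realNilradical_le_lieAlgebraOf (X : lieAlgebraOf GR) :
    realNilradical GR X ≤ (lieAlgebraOf GR).toSubmodule :=
  iSup₂_le fun _ _ => inf_le_left

theorem mem_complexNilradical_of_mem_realNilradical {x X : Matrix (Fin n) (Fin n) ℂ}
    (hX : X ∈ realNilradical GR x) : X ∈ complexNilradical GR x := by
  suffices realNilradical GR x ≤ (complexNilradical GR x).restrictScalars ℝ from this hX
  refine iSup₂_le fun μ hμ Y hY => ?_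
  obtain ⟨hYL, hYe⟩ := hY
  refine Submodule.mem_iSup_of_mem μ (Submodule.mem_iSup_of_mem hμ ⟨Submodule.subset_span hYL, ?_⟩)
  rw [SetLike.mem_coe, Module.End.mem_eigenspace_iff] at hYe ⊢
  exact hYe

/-- For `c ≠ 0` the elements `c h + x` with `x` in the nilradical are conjugate to `c h`. -/
theorem smul_add_mem_adjointOrbit [Finite ι] (hb : ∀ k, ⁅h, b k⁆ = (d k : ℝ) • b k) {c : ℝ}
    (hc : c ≠ 0) {x : lieAlgebraOf GR} (hx : x ∈ b.geWeight d 1) :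
    (c • h + x : Matrix (Fin n) (Fin n) ℂ) ∈ adjointOrbit GR.toSubgroup (c • h) := by
  classical
  have := Fintype.ofFinite ι
  let _ : NormedRing (Matrix (Fin n) (Fin n) ℂ) := Matrix.linftyOpNormedRing
  let _ : NormedAlgebra ℝ (Matrix (Fin n) (Fin n) ℂ) := Matrix.linftyOpNormedAlgebra
  let F : ℕ → Submodule ℝ (Matrix (Fin n) (Fin n) ℂ) := fun k =>
    (b.geWeight d k).map ((lieAlgebraOf GR).incl : lieAlgebraOf GR →ₗ[ℝ] _)
  obtain ⟨N, hN⟩ : ∃ N : ℕ, ∀ k, d k < N := by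
    refine ⟨∑ k, (d k).toNat + 1, fun k => ?_⟩
    have := Finset.single_le_sum (f := fun k => (d k).toNat) (fun _ _ => Nat.zero_le _)
      (Finset.mem_univ k)
    have h2 := Int.self_le_toNat (d k)
    push_cast
    zify at this
    omega
  suffices H : ∃ g ∈ GR.toSubgroup, (g : Matrix (Fin n) (Fin n) ℂ) *
      (c • (h : Matrix (Fin n) (Fin n) ℂ)) * ((g⁻¹ : GL (Fin n) ℂ) : Matrix (Fin n) (Fin n) ℂ) =
      c • (h : Matrix (Fin n) (Fin n) ℂ) + x by
    obtain ⟨g, hg, hg'⟩ := H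
    exact ⟨g, hg, hg'.symm⟩
  refine exists_conj_eq_add GR.toSubgroup F (c • (h : Matrix (Fin n) (Fin n) ℂ))
    (fun i j hij => Submodule.map_mono (Module.Basis.geWeight_anti (by exact_mod_cast hij)))
    (N := N) ?_ ?_ ?_ ?_ (x := x) ⟨x, by exact_mod_cast hx, rfl⟩
  · rw [eq_bot_iff]
    rintro _ ⟨y, hy, rfl⟩
    have : y = 0 := b.ext_elem fun k => by simpa using hy k (hN k)
    simp [this]
  · rintro _ ⟨y, -, rfl⟩
    obtain ⟨g, hg, hg'⟩ := y.2 1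
    rw [one_smul] at hg'
    exact ⟨g, hg, hg'⟩
  · rintro k hk _ ⟨y, hy, rfl⟩
    -- Bracketing `c h` with an element of weight `k` scales it by `k c`; dividing by this factor
    -- cancels exactly the component of weight `k`.
    refine ⟨_, ⟨((k : ℝ) * c)⁻¹ • y, Submodule.smul_mem _ _ hy, rfl⟩,
      ⟨y - ((k : ℝ) * c)⁻¹ • (c • ⁅h, y⁆), fun l hl => ?_, ?_⟩⟩
    · have hk0 : (k : ℝ) ≠ 0 := by positivity
      have h1 : b.repr (y - ((k : ℝ) * c)⁻¹ • (c • ⁅h, y⁆)) l =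
          b.repr y l - ((k : ℝ) * c)⁻¹ * (c * ((d l : ℝ) * b.repr y l)) := by
        simp [repr_lie_eigenbasis hb]
      rw [h1]
      rcases lt_or_ge (d l) k with hlt | hge
      · rw [hy l hlt]; simp
      · have : d l = k := by push_cast at hl; omega
        rw [this]
        push_cast
        field_simp
        ring
    · have key : ∀ (H Y : Matrix (Fin n) (Fin n) ℂ) (r : ℝ), Y - r • (c • (H * Y - Y * H)) =
          Y + ((r • Y) * (c • H) - (c • H) * (r • Y)) := by
        intro H Y r
        rw [smul_mul_smul_comm, smul_mul_smul_comm, smul_smul, mul_comm c, smul_sub]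
        abel
      exact key h y _
  · rintro k hk _ ⟨y, hy, rfl⟩ _ ⟨x, hx, rfl⟩
    exact ⟨⁅y, x⁆, Module.Basis.geWeight_anti (by push_cast; omega) (lie_mem_geWeight hb hy hx), rfl⟩

theorem adjointOrbit_smul_subset {H : Subgroup (GL (Fin n) ℂ)} {X Y : Matrix (Fin n) (Fin n) ℂ}
    (hY : Y ∈ adjointOrbit H X) (c : ℝ) : adjointOrbit H (c • Y) = adjointOrbit H (c • X) := by
  refine adjointOrbit_eq_of_mem ?_
  obtain ⟨g, hg, rfl⟩ := hY
  exact ⟨g, hg, by simp⟩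

theorem limitOfOrbits_eq_of_mem_adjointOrbit {X Y : Matrix (Fin n) (Fin n) ℂ}
    (hY : Y ∈ adjointOrbit GR.toSubgroup X) : limitOfOrbits GR Y = limitOfOrbits GR X := by
  simp only [limitOfOrbits, adjointOrbit_smul_subset hY]

/-- The limit set of a nilpotent element is computed by any of its standard triples. -/
theorem limitSet_eq_limitOfOrbits {e f : lieAlgebraOf GR} (ht : IsStandardTriple h e f) :
    limitSet GR e = limitOfOrbits GR h := by
  obtain ⟨b, d, hb⟩ := ht.exists_eigenbasis (K := ℝ)
  refine Set.Subset.antisymm ?_ ?_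
  · refine Set.iUnion_subset fun h' => Set.iUnion_subset fun f' => Set.iUnion_subset fun ht' => ?_
    refine (limitOfOrbits_eq_of_mem_adjointOrbit ?_).subset
    have := smul_add_mem_adjointOrbit hb one_ne_zero (ht.sub_mem_geWeight hb ht')
    simpa using this
  · exact Set.subset_iUnion_of_subset h (Set.subset_iUnion_of_subset f
      (Set.subset_iUnion_of_subset ht subset_rfl))

theorem adjointOrbit_subset_limitOfOrbits [Finite ι] (hb : ∀ k, ⁅h, b k⁆ = (d k : ℝ) • b k)
    {X : Matrix (Fin n) (Fin n) ℂ} (hX : X ∈ realNilradical GR h) :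
    adjointOrbit GR.toSubgroup X ⊆ limitOfOrbits GR h := by
  obtain ⟨x, hx, rfl⟩ := (mem_realNilradical_iff hb).1 hX
  rintro _ ⟨g, hg, rfl⟩
  refine Set.mem_iInter₂.2 fun ε hε => ?_
  let c : ℝ → Matrix (Fin n) (Fin n) ℂ := fun ν => (g : Matrix (Fin n) (Fin n) ℂ) *
    (ν • (h : Matrix (Fin n) (Fin n) ℂ) + x) * ((g⁻¹ : GL (Fin n) ℂ) : Matrix (Fin n) (Fin n) ℂ)
  have hc : Tendsto c (𝓝[>] 0) (𝓝 ((g : Matrix (Fin n) (Fin n) ℂ) * x *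
      ((g⁻¹ : GL (Fin n) ℂ) : Matrix (Fin n) (Fin n) ℂ))) := by
    have h1 : Continuous c := by fun_prop
    have h2 := h1.tendsto 0
    simp only [c, zero_smul, zero_add] at h2
    exact h2.mono_left nhdsWithin_le_nhds
  refine mem_closure_of_tendsto hc ?_
  filter_upwards [Ioo_mem_nhdsGT hε] with ν hν
  exact Set.mem_iUnion₂.2 ⟨ν, hν, conj_mem_adjointOrbit hg
    (smul_add_mem_adjointOrbit hb hν.1.ne' hx)⟩

theorem isClosed_limitOfOrbits (X : Matrix (Fin n) (Fin n) ℂ) : IsClosed (limitOfOrbits GR X) :=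
  isClosed_biInter fun _ _ => isClosed_closure

end RealNilradical

/-! ## The limit of the orbits of the neutral element -/

noncomputable section LimitOfOrbits

open NormedSpace Matrix Topology Filter

theorem LinearMap.exists_norm_le_of_norm_le {E F : Type*} [NormedAddCommGroup E] [NormedSpace ℝ E]
    [FiniteDimensional ℝ E] [NormedAddCommGroup F] [NormedSpace ℝ F] (T : E →ₗ[ℝ] F) (C : ℝ) :
    ∃ C' : ℝ, ∀ x, ‖x‖ ≤ C → ‖T x‖ ≤ C' := by
  refine ⟨‖LinearMap.toContinuousLinearMap T‖ * C, fun x hx => ?_⟩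
  exact ((LinearMap.toContinuousLinearMap T).le_opNorm x).trans (by gcongr)

/-- Points of `P ν` are within `ν C` of `S`, and this distance disappears as `ν → 0`. -/
theorem iInter_closure_subset_closure {E : Type*} [NormedAddCommGroup E] [NormedSpace ℝ E]
    {P : ℝ → Set E} {S : Set E} {C : ℝ}
    (h : ∀ ν, 0 < ν → ∀ z ∈ P ν, ∃ a, ‖a‖ ≤ C ∧ z - ν • a ∈ S) :
    ⋂ ε ∈ Set.Ioi (0 : ℝ), closure (⋃ ν ∈ Set.Ioo (0 : ℝ) ε, P ν) ⊆ closure S := by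
  intro y hy
  rw [Metric.mem_closure_iff]
  intro δ hδ
  have hε : 0 < δ / 2 / (|C| + 1) := by positivity
  obtain ⟨z, hz, hyz⟩ := Metric.mem_closure_iff.1 (Set.mem_iInter₂.1 hy _ hε) (δ / 2)
    (by positivity)
  obtain ⟨ν, hν, hzν⟩ := Set.mem_iUnion₂.1 hz
  obtain ⟨a, ha, haS⟩ := h ν hν.1 z hzν
  refine ⟨_, haS, ?_⟩
  have hdist : dist z (z - ν • a) < δ / 2 := by
    rw [dist_eq_norm, sub_sub_cancel, norm_smul, Real.norm_of_nonneg hν.1.le]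
    calc ν * ‖a‖ ≤ ν * (|C| + 1) := by
          have := hν.1.le
          have := le_abs_self C
          gcongr
          linarith
      _ < δ / 2 / (|C| + 1) * (|C| + 1) := by
          have := hν.2
          gcongr
      _ = δ / 2 := by field_simp
  linarith [dist_triangle y z (z - ν • a)]

variable {n : ℕ} {GR : ClosedSubgroup (GL (Fin n) ℂ)}

/-- The conjugates of the neutral element are at bounded distance from the conjugates of the
nilradical. -/
theorem limitOfOrbits_subset_closure {ι : Type*} [Fintype ι]
    {b : Module.Basis ι ℝ (lieAlgebraOf GR)} {d : ι → ℤ} {h : lieAlgebraOf GR}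
    (hsimple : LieAlgebra.IsSimple ℝ (lieAlgebraOf GR))
    (hb : ∀ k, ⁅h, b k⁆ = (d k : ℝ) • b k) :
    limitOfOrbits GR h ⊆
      closure (⋃ x ∈ realNilradical GR h, adjointOrbit GR.toSubgroup x) := by
  let _ : NormedRing (Matrix (Fin n) (Fin n) ℂ) := Matrix.linftyOpNormedRing
  let _ : NormedAlgebra ℝ (Matrix (Fin n) (Fin n) ℂ) := Matrix.linftyOpNormedAlgebra
  have hrep : ∃ C : ℝ, ∀ g, ∀ hg : g ∈ GR, ∃ a : lieAlgebraOf GR,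
      ‖(a : Matrix (Fin n) (Fin n) ℂ)‖ ≤ C ∧
        ∃ x ∈ b.geWeight d 1, conjLieEquiv g hg h = a + conjLieEquiv g hg x := by
    -- For `h ≠ 0` the self-pairing of `h` is a sum of squares of weights; were it zero, `h` would
    -- be central. This yields nondegeneracy of the Killing form.
    rcases eq_or_ne h 0 with rfl | h0
    · exact ⟨0, fun g hg => ⟨0, by simp, 0, Submodule.zero_mem _, by simp⟩⟩
    · have hκ : killingForm ℝ (lieAlgebraOf GR) h h ≠ 0 := by
        rw [killingForm_eigenbasis_self hb]
        intro hsum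
        have hd : ∀ k, (d k : ℝ) = 0 := fun k => by
          have := (Finset.sum_eq_zero_iff_of_nonneg fun k _ => sq_nonneg (d k : ℝ)).1 hsum k
            (Finset.mem_univ k)
          exact pow_eq_zero_iff two_ne_zero |>.1 this
        have hz : ∀ x : lieAlgebraOf GR, ⁅h, x⁆ = 0 := fun x =>
          b.ext_elem fun k => by rw [repr_lie_eigenbasis hb, hd]; simp
        refine h0 ?_
        have hc : h ∈ LieAlgebra.center ℝ (lieAlgebraOf GR) := by
          rw [LieModule.mem_maxTrivSubmodule]
          intro x
          rw [← lie_skew, hz, neg_zero]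
        rw [LieAlgebra.center_eq_bot] at hc
        simpa using hc
      have : FiniteDimensional ℝ (lieAlgebraOf GR) := Module.Finite.of_basis b
      let ψ : lieAlgebraOf GR ≃ₗ[ℝ] EuclideanSpace ℝ (Fin (Fintype.card ι)) :=
        (b.reindex (Fintype.equivFin ι)).equivFun.trans (WithLp.linearEquiv 2 ℝ _).symm
      obtain ⟨C, hC⟩ := exists_bounded_representative hb
        (killingForm_nondegenerate_of_isSimple hsimple hκ) ψ
      obtain ⟨C', hC'⟩ := LinearMap.exists_norm_le_of_norm_le
        (((lieAlgebraOf GR).incl : lieAlgebraOf GR →ₗ[ℝ] Matrix (Fin n) (Fin n) ℂ) ∘ₗ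
          ψ.symm.toLinearMap) C
      refine ⟨C', fun g hg => ?_⟩
      obtain ⟨a, ha, hx⟩ := hC (conjLieEquiv g hg)
      exact ⟨a, by simpa using hC' _ ha, hx⟩
  obtain ⟨C, hC⟩ := hrep
  refine iInter_closure_subset_closure (C := C) ?_
  rintro ν - _ ⟨g, hg, rfl⟩
  obtain ⟨a, ha, x, hx, hax⟩ := hC g hg
  refine ⟨a, ha, Set.mem_iUnion₂.2 ⟨_, (mem_realNilradical_iff hb).2
    ⟨ν • x, Submodule.smul_mem _ _ hx, rfl⟩, g, hg, ?_⟩⟩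
  have hax' : (g : Matrix (Fin n) (Fin n) ℂ) * h * ((g⁻¹ : GL (Fin n) ℂ) : Matrix (Fin n) (Fin n) ℂ) =
      a + (g : Matrix (Fin n) (Fin n) ℂ) * x * ((g⁻¹ : GL (Fin n) ℂ) : Matrix (Fin n) (Fin n) ℂ) :=
    congrArg Subtype.val hax
  have h1 : ((ν • x : lieAlgebraOf GR) : Matrix (Fin n) (Fin n) ℂ) = ν • x := rfl
  rw [h1, mul_smul_comm, mul_smul_comm, smul_mul_assoc, smul_mul_assoc, hax', smul_add,
    add_sub_cancel_left]

end LimitOfOrbits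

/-! ### Spanning and generation by nilpotent elements. -/

noncomputable section NilpotentGeneration

open NormedSpace Matrix Topology Filter

variable {n : ℕ} {GR : ClosedSubgroup (GL (Fin n) ℂ)}

/-- A simple Lie algebra of matrices is spanned by its nilpotent elements if it has a nonzero
nilpotent element. -/
theorem span_nilpotent_eq_top (hsimple : LieAlgebra.IsSimple ℝ (lieAlgebraOf GR))
    {e : lieAlgebraOf GR} (he : IsNilpotent (e : Matrix (Fin n) (Fin n) ℂ)) (he0 : e ≠ 0) :
    Submodule.span ℝ {x : lieAlgebraOf GR | IsNilpotent (x : Matrix (Fin n) (Fin n) ℂ)} = ⊤ := by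
  let _ : NormedRing (Matrix (Fin n) (Fin n) ℂ) := Matrix.linftyOpNormedRing
  let _ : NormedAlgebra ℝ (Matrix (Fin n) (Fin n) ℂ) := Matrix.linftyOpNormedAlgebra
  set S := Submodule.span ℝ {x : lieAlgebraOf GR | IsNilpotent (x : Matrix (Fin n) (Fin n) ℂ)}
  have hconj : ∀ (g : GL (Fin n) ℂ) (hg : g ∈ GR), ∀ x ∈ S, conjLieEquiv g hg x ∈ S := by
    intro g hg
    suffices S ≤ S.comap ((conjLieEquiv g hg : lieAlgebraOf GR →ₗ⁅ℝ⁆ lieAlgebraOf GR) :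
      lieAlgebraOf GR →ₗ[ℝ] lieAlgebraOf GR) from this
    refine Submodule.span_le.2 ?_
    rintro x ⟨N, hN⟩
    refine Submodule.subset_span ⟨N, ?_⟩
    change ((g : Matrix (Fin n) (Fin n) ℂ) * x * ((g⁻¹ : GL (Fin n) ℂ) : Matrix (Fin n) (Fin n) ℂ)) ^ N = 0
    rw [Units.conj_pow, hN]
    simp
  let T : Submodule ℝ (Matrix (Fin n) (Fin n) ℂ) :=
    S.map ((lieAlgebraOf GR).incl : lieAlgebraOf GR →ₗ[ℝ] _)
  have hT : IsClosed (T : Set (Matrix (Fin n) (Fin n) ℂ)) := Submodule.closed_of_finiteDimensional _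
  -- Conjugation preserves nilpotency, hence `S`; differentiating it along one-parameter groups
  -- makes `S` an ideal.
  have hlie : ∀ y x : lieAlgebraOf GR, x ∈ S → ⁅y, x⁆ ∈ S := by
    intro y x hx
    suffices hmem : (y : Matrix (Fin n) (Fin n) ℂ) * (x : Matrix (Fin n) (Fin n) ℂ) - x * y ∈ T by
      obtain ⟨w, hw, hw'⟩ := hmem
      have : w = ⁅y, x⁆ := Subtype.ext hw'
      exact this ▸ hw
    have hd : HasDerivAt (fun s : ℝ => exp (s • (y : Matrix (Fin n) (Fin n) ℂ)) * x *
        exp (s • (-(y : Matrix (Fin n) (Fin n) ℂ) : Matrix (Fin n) (Fin n) ℂ)))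
        ((y : Matrix (Fin n) (Fin n) ℂ) * x - x * y) 0 := by
      have h1 := ((hasDerivAt_exp_smul_const (𝕂 := ℝ) (y : Matrix (Fin n) (Fin n) ℂ)
        (0 : ℝ)).mul_const (x : Matrix (Fin n) (Fin n) ℂ)).mul
        (hasDerivAt_exp_smul_const (𝕂 := ℝ) (-(y : Matrix (Fin n) (Fin n) ℂ) : Matrix (Fin n) (Fin n) ℂ) (0 : ℝ))
      have h2 : HasDerivAt (fun s : ℝ => exp (s • (y : Matrix (Fin n) (Fin n) ℂ)) * x *
        exp (s • (-(y : Matrix (Fin n) (Fin n) ℂ) : Matrix (Fin n) (Fin n) ℂ))) _ 0 := h1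
      simpa [sub_eq_add_neg] using h2
    have hmem : ∀ s : ℝ, exp (s • (y : Matrix (Fin n) (Fin n) ℂ)) * x *
        exp (s • (-(y : Matrix (Fin n) (Fin n) ℂ) : Matrix (Fin n) (Fin n) ℂ)) ∈ T := by
      intro s
      obtain ⟨g, hg, hg'⟩ := y.2 s
      refine ⟨_, hconj g hg x hx, ?_⟩
      rw [smul_neg, ← GeneralLinearGroup.inv_eq_exp_neg hg']
      erw [← hg']
      rfl
    refine hT.mem_of_tendsto (hasDerivAt_iff_tendsto_slope.1 hd)
      (Eventually.of_forall fun s => ?_)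
    rw [slope_def_module]
    exact T.smul_mem _ (T.sub_mem (hmem _) (hmem _))
  let I : LieIdeal ℝ (lieAlgebraOf GR) := { S with lie_mem := fun {y x} hx => hlie y x hx }
  have heI : e ∈ I := Submodule.subset_span he
  have hI : I = ⊤ := (hsimple.eq_bot_or_eq_top I).resolve_left fun hbot => he0 <| by
    rw [hbot] at heI
    simpa using heI
  have : (I : Submodule ℝ (lieAlgebraOf GR)) = S := rfl
  rw [← this, hI]
  rfl

theorem unipotentGroup_le_complexification :
    unipotentGroup (lieAlgebraOf GR : Set (Matrix (Fin n) (Fin n) ℂ)) ≤ complexification GR := by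
  refine Subgroup.closure_mono ?_
  rintro g ⟨x, hx, -, t, hg⟩
  exact ⟨t • x, Submodule.smul_mem _ _ (Submodule.subset_span hx), hg⟩

/-- If the nilpotent elements span the Lie algebra, they generate a dense subgroup of the
complexification. -/
theorem complexification_le_topologicalClosure
    (hspan : Submodule.span ℝ {x : lieAlgebraOf GR | IsNilpotent (x : Matrix (Fin n) (Fin n) ℂ)} =
      ⊤) :
    complexification GR ≤
      (unipotentGroup (lieAlgebraOf GR : Set (Matrix (Fin n) (Fin n) ℂ))).topologicalClosure := by
  let _ : NormedRing (Matrix (Fin n) (Fin n) ℂ) := Matrix.linftyOpNormedRing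
  let _ : NormedAlgebra ℝ (Matrix (Fin n) (Fin n) ℂ) := Matrix.linftyOpNormedAlgebra
  set Γ := unipotentGroup (lieAlgebraOf GR : Set (Matrix (Fin n) (Fin n) ℂ))
  -- The generators of a closed group form a real subspace. For the closure of `Γ` it contains all
  -- complex multiples of nilpotent elements, hence everything they span.
  let H : ClosedSubgroup (GL (Fin n) ℂ) :=
    { Γ.topologicalClosure with isClosed' := Γ.isClosed_topologicalClosure }
  have hreal : ∀ (c : ℂ) (x : lieAlgebraOf GR), c • (x : Matrix (Fin n) (Fin n) ℂ) ∈
      H.generators := by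
    intro c x
    let φ : lieAlgebraOf GR →ₗ[ℝ] Matrix (Fin n) (Fin n) ℂ :=
      (LinearMap.lsmul ℂ (Matrix (Fin n) (Fin n) ℂ) c).restrictScalars ℝ ∘ₗ
        ((lieAlgebraOf GR).incl : lieAlgebraOf GR →ₗ[ℝ] _)
    have hle : (⊤ : Submodule ℝ (lieAlgebraOf GR)) ≤ H.generators.comap φ := by
      rw [← hspan]
      refine Submodule.span_le.2 fun x hx t => ?_
      obtain ⟨g, hg⟩ := GeneralLinearGroup.exists_eq_exp
        ((t * c : ℂ) • (x : Matrix (Fin n) (Fin n) ℂ))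
      refine ⟨g, Γ.le_topologicalClosure (Subgroup.subset_closure ⟨x, x.2, hx, _, hg⟩), ?_⟩
      have : t • φ x = (t * c : ℂ) • (x : Matrix (Fin n) (Fin n) ℂ) := by
        rw [mul_smul, ← Complex.coe_smul]
        rfl
      rw [this]
      exact hg
    exact hle (Submodule.mem_top (x := x))
  have hcomplex : ∀ X ∈ complexLieAlgebraOf GR, ∀ c : ℂ, c • X ∈ H.generators := by
    intro X hX
    induction hX using Submodule.span_induction with
    | mem x hx => exact fun c => hreal c ⟨x, hx⟩
    | zero => intro c; rw [smul_zero]; exact zero_mem _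
    | add x y _ _ hx hy => intro c; rw [smul_add]; exact add_mem (hx c) (hy c)
    | smul a x _ hx => intro c; rw [smul_smul]; exact hx _
  refine (Subgroup.closure_le _).2 ?_
  rintro g ⟨X, hX, hg⟩
  obtain ⟨k, hk, hk'⟩ := hcomplex X hX 1 1
  rw [one_smul, one_smul] at hk'
  have : g = k := Units.ext (hg.trans hk'.symm)
  rw [this]
  exact hk

theorem closure_adjointOrbit_subset {Γ H : Subgroup (GL (Fin n) ℂ)} (h : H ≤ Γ.topologicalClosure)
    (z : Matrix (Fin n) (Fin n) ℂ) :
    closure (adjointOrbit H z) ⊆ closure (adjointOrbit Γ z) := by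
  refine closure_minimal ?_ isClosed_closure
  rintro _ ⟨g, hg, rfl⟩
  have hcont : Continuous fun g : GL (Fin n) ℂ => (g : Matrix (Fin n) (Fin n) ℂ) * z *
      ((g⁻¹ : GL (Fin n) ℂ) : Matrix (Fin n) (Fin n) ℂ) :=
    (Units.continuous_val.mul continuous_const).mul Units.continuous_coe_inv
  refine closure_mono ?_ (image_closure_subset_closure_image hcont ⟨g, h hg, rfl⟩)
  rintro _ ⟨k, hk, rfl⟩
  exact ⟨k, hk, rfl⟩

end NilpotentGeneration

/-! ## Density of the real points of the Richardson orbit -/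

noncomputable section RichardsonOrbit

open NormedSpace Matrix Topology Filter

/-- On the line, `q` is a one-variable polynomial that is nonzero at the parameter 0, so it has
finitely many roots. -/
theorem MvPolynomial.dense_setOf_eval_line_ne_zero {ι : Type*} (q : MvPolynomial ι ℂ) (s v : ι → ℂ)
    (hq : MvPolynomial.eval s q ≠ 0) :
    Dense {τ : ℝ | MvPolynomial.eval (fun i => s i + τ * v i) q ≠ 0} := by
  let P : Polynomial ℂ := MvPolynomial.aeval
    (fun i => Polynomial.C (s i) + Polynomial.X * Polynomial.C (v i)) q
  have hP : ∀ τ : ℂ, P.eval τ = MvPolynomial.eval (fun i => s i + τ * v i) q := by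
    intro τ
    rw [← MvPolynomial.aeval_eq_eval, ← Polynomial.coe_aeval_eq_eval]
    change ((Polynomial.aeval τ).comp (MvPolynomial.aeval _)) q = _
    rw [MvPolynomial.comp_aeval]
    congr 2
    funext i
    change Polynomial.aeval τ (Polynomial.C (s i) + Polynomial.X * Polynomial.C (v i)) = _
    rw [Polynomial.coe_aeval_eq_eval]
    simp [mul_comm (v i)]
  have hP0 : P ≠ 0 := by
    intro h0
    have := hP 0
    rw [h0] at this
    simp at this
    exact hq this.symm
  have hfin : {τ : ℝ | P.eval (τ : ℂ) = 0}.Finite := by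
    refine ((Polynomial.finite_setOfPred_isRoot hP0).preimage
      (Complex.ofReal_injective.injOn (s := _))).subset ?_
    intro τ hτ
    exact hτ
  have := hfin.countable.dense_compl ℝ
  refine this.mono fun τ hτ => ?_
  rw [Set.mem_ofPred_eq, ← hP]
  exact hτ

variable {n : ℕ} {GR : ClosedSubgroup (GL (Fin n) ℂ)}

theorem conj_mem_nilradicalSaturation {x X : Matrix (Fin n) (Fin n) ℂ} {g : GL (Fin n) ℂ}
    (hg : g ∈ complexification GR) (hX : X ∈ nilradicalSaturation GR x) :
    (g : Matrix (Fin n) (Fin n) ℂ) * X * ((g⁻¹ : GL (Fin n) ℂ) : Matrix (Fin n) (Fin n) ℂ) ∈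
      nilradicalSaturation GR x := by
  obtain ⟨z, hz, hX⟩ := Set.mem_iUnion₂.1 hX
  exact Set.mem_iUnion₂.2 ⟨z, hz, conj_mem_adjointOrbit hg hX⟩

theorem mem_nilradicalSaturation {x X : Matrix (Fin n) (Fin n) ℂ}
    (hX : X ∈ complexNilradical GR x) : X ∈ nilradicalSaturation GR x :=
  Set.mem_iUnion₂.2 ⟨X, hX, mem_adjointOrbit_self _ X⟩

theorem mem_richardsonOrbit_of_mem_adjointOrbit {x z y : Matrix (Fin n) (Fin n) ℂ}
    (hz : z ∈ richardsonOrbit GR x) (hy : y ∈ adjointOrbit (complexification GR) z) :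
    y ∈ richardsonOrbit GR x := by
  refine ⟨?_, ?_⟩
  · obtain ⟨g, hg, rfl⟩ := hy
    exact conj_mem_nilradicalSaturation hg hz.1
  · rw [adjointOrbit_eq_of_mem hy]
    exact hz.2

/-- If the Richardson orbit meets the real nilradical, it is dense there. -/
theorem realNilradical_subset_closure
    (hspan : Submodule.span ℝ {x : lieAlgebraOf GR | IsNilpotent (x : Matrix (Fin n) (Fin n) ℂ)} =
      ⊤) {h : lieAlgebraOf GR} {z : Matrix (Fin n) (Fin n) ℂ} (hz : z ∈ richardsonOrbit GR h)
    (hzu : z ∈ realNilradical GR h) {w : Matrix (Fin n) (Fin n) ℂ} (hw : w ∈ realNilradical GR h) :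
    w ∈ closure (richardsonOrbit GR h ∩
      (lieAlgebraOf GR : Set (Matrix (Fin n) (Fin n) ℂ))) := by
  obtain ⟨q, ⟨s, ⟨g, hg, rfl⟩, hs⟩, hq⟩ := exists_eval_ne_zero_forall_mem_adjointOrbit
    (lieAlgebraOf GR : Set (Matrix (Fin n) (Fin n) ℂ)) z
  have hgG := unipotentGroup_le_complexification hg
  -- The polynomial `q` is known to be nonzero at a conjugate of `z`, perhaps not at `z`, so the
  -- line from `z` to `w` is conjugated as well.
  let conj : Matrix (Fin n) (Fin n) ℂ → Matrix (Fin n) (Fin n) ℂ := fun y =>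
    (g : Matrix (Fin n) (Fin n) ℂ) * y * ((g⁻¹ : GL (Fin n) ℂ) : Matrix (Fin n) (Fin n) ℂ)
  have hdense := MvPolynomial.dense_setOf_eval_line_ne_zero q (conj z).entries
    (conj (w - z)).entries hs
  have hcont : Continuous fun τ : ℝ => z + τ • (w - z) := by fun_prop
  have h1 := image_closure_subset_closure_image hcont ⟨1, hdense 1, rfl⟩
  simp only [one_smul, add_sub_cancel] at h1
  refine closure_mono ?_ h1
  rintro _ ⟨τ, hτ, rfl⟩
  have hu : z + τ • (w - z) ∈ realNilradical GR h :=
    add_mem hzu (Submodule.smul_mem _ _ (sub_mem hw hzu))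
  refine ⟨mem_richardsonOrbit_of_mem_adjointOrbit hz ?_, realNilradical_le_lieAlgebraOf h hu⟩
  have hcl : conj (z + τ • (w - z)) ∈
      closure (adjointOrbit (unipotentGroup (lieAlgebraOf GR : Set (Matrix _ _ ℂ))) z) :=
    closure_adjointOrbit_subset (complexification_le_topologicalClosure hspan) z
      (hz.2 (conj_mem_nilradicalSaturation hgG
        (mem_nilradicalSaturation (mem_complexNilradical_of_mem_realNilradical hu))))
  have hentries : (conj (z + τ • (w - z))).entries =
      fun i => (conj z).entries i + τ * (conj (w - z)).entries i := by
    have : conj (z + τ • (w - z)) = conj z + τ • conj (w - z) := by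
      simp only [conj, mul_add, add_mul, mul_smul_comm, smul_mul_assoc]
    rw [this]
    funext i
    simp [Matrix.entries]
  have hmem := adjointOrbit_mono unipotentGroup_le_complexification z
    (hq _ hcl (by rw [hentries]; exact hτ))
  have := conj_mem_adjointOrbit (inv_mem hgG) hmem
  simpa [conj, mul_assoc] using this

end RichardsonOrbit

/-! ### The limit set and the real points of the Richardson orbit. -/

theorem proposition7p4 {n : ℕ} (GR : ClosedSubgroup (GL (Fin n) ℂ))
    (hconn : IsConnected (GR : Set (GL (Fin n) ℂ)))
    (hsimple : LieAlgebra.IsSimple ℝ (lieAlgebraOf GR))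
    -- `g = gR + i gR` is the complexification of `gR`, i.e. the sum is direct
    (hreal : ∀ X ∈ lieAlgebraOf GR, Complex.I • X ∈ lieAlgebraOf GR → X = 0)
    (e h f : lieAlgebraOf GR)
    (he : IsNilpotent (LieAlgebra.ad ℝ (lieAlgebraOf GR) e))
    (htriple : IsStandardTriple h e f)
    -- the Richardson orbit of `h` has real forms
    (hex : ∃ O', IsRealForm GR (richardsonOrbit GR h) O')
    -- and each of them meets `uR(h)`
    (hmeet : ∀ O', IsRealForm GR (richardsonOrbit GR h) O' →
      (O' ∩ (realNilradical GR h : Set (Matrix (Fin n) (Fin n) ℂ))).Nonempty) :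
    limitSet GR e = closure (richardsonOrbit GR h ∩
      (lieAlgebraOf GR : Set (Matrix (Fin n) (Fin n) ℂ))) := by
  obtain ⟨b, d, hb⟩ := htriple.exists_eigenbasis (K := ℝ)
  have hle := le_complexification hconn
  rw [limitSet_eq_limitOfOrbits htriple]
  refine Set.Subset.antisymm ?_ ?_
  · refine (limitOfOrbits_subset_closure hsimple hb).trans (closure_minimal ?_ isClosed_closure)
    obtain ⟨_, z₀, ⟨hz₀, hz₀L⟩, rfl⟩ := hex
    obtain ⟨z, hz, hzu⟩ := hmeet _ ⟨z₀, ⟨hz₀, hz₀L⟩, rfl⟩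
    have hzR : z ∈ richardsonOrbit GR h :=
      mem_richardsonOrbit_of_mem_adjointOrbit hz₀ (adjointOrbit_mono hle _ hz)
    have hu : ∀ w ∈ realNilradical GR h, w ∈ closure (richardsonOrbit GR h ∩
        (lieAlgebraOf GR : Set (Matrix (Fin n) (Fin n) ℂ))) := by
      intro w hw
      -- Spanning by nilpotent elements needs `e ≠ 0`. For `e = 0` the neutral element and its
      -- nilradical vanish.
      rcases eq_or_ne e 0 with he0 | he0
      · have h0 : h = 0 := by rw [← htriple.lie_e_f, he0, zero_lie]
        have hzero : ∀ y ∈ realNilradical GR h, y = 0 := by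
          intro y hy
          obtain ⟨x, hx, rfl⟩ := (mem_realNilradical_iff hb).1 hy
          have : x = 0 := b.ext_elem fun k => by
            have hdk : d k = 0 := by
              have := hb k
              rw [h0, zero_lie, eq_comm, smul_eq_zero_iff_left (b.ne_zero k)] at this
              exact_mod_cast this
            simpa using hx k (by omega)
          simp [this]
        rw [hzero w hw, ← hzero z hzu]
        exact subset_closure ⟨hzR, realNilradical_le_lieAlgebraOf h hzu⟩
      -- Nilpotency as a matrix, not only of `ad e`, is required; it follows from `[h, e] = 2e`.
      · have hen : IsNilpotent (e : Matrix (Fin n) (Fin n) ℂ) := by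
          have hcomm : (h : Matrix (Fin n) (Fin n) ℂ) * e - e * h =
              (2 : ℂ) • (e : Matrix (Fin n) (Fin n) ℂ) := by
            have h1 : (h : Matrix (Fin n) (Fin n) ℂ) * e - e * h =
                2 • (e : Matrix (Fin n) (Fin n) ℂ) := congrArg Subtype.val htriple.lie_h_e
            rw [h1, ← Nat.cast_smul_eq_nsmul ℂ]
            norm_num
          have h2 := isNilpotent_of_commutator_eq_smul (Matrix.toLinAlgEquiv' (h : Matrix _ _ ℂ))
            (Matrix.toLinAlgEquiv' (e : Matrix (Fin n) (Fin n) ℂ)) (two_ne_zero (α := ℂ))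
            (by rw [← map_mul, ← map_mul, ← map_sub, hcomm, map_smul])
          exact (IsNilpotent.map_iff Matrix.toLinAlgEquiv'.injective).1 h2
        exact realNilradical_subset_closure (span_nilpotent_eq_top hsimple hen he0) hzR hzu hw
    refine Set.iUnion₂_subset fun w hw => ?_
    rintro _ ⟨g, hg, rfl⟩
    refine closure_mono ?_ (image_closure_subset_closure_image (continuous_conj g) ⟨w, hu w hw, rfl⟩)
    rintro _ ⟨y, ⟨hyR, hyL⟩, rfl⟩
    exact ⟨mem_richardsonOrbit_of_mem_adjointOrbit hyR ⟨g, hle hg, rfl⟩,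
      conj_mem_lieAlgebraOf hg hyL⟩
  · refine closure_minimal ?_ (isClosed_limitOfOrbits _)
    rintro z ⟨hzR, hzL⟩
    obtain ⟨w, hw, hwu⟩ := hmeet _ ⟨z, ⟨hzR, hzL⟩, rfl⟩
    exact adjointOrbit_subset_limitOfOrbits hb hwu (mem_adjointOrbit_comm hw)
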